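/- Let $\mathcal S(\mathbb R)$ be the Schwartz space of complex-valued functions of $q$, and let $$D_s=\mathrm i\,q\,\partial_y-\partial_x\partial_q$$ be the symplectic Dirac operator acting on $\mathrm{Pol}(\mathbb R^2,\mathbb C)\otimes\mathcal S(\mathbb R)$, where $x,y$ are the coordinates of $\mathbb R^2$. For $h\in\mathbb N_0$ let $$M_h^s=\big(\mathrm{Pol}_h(\mathbb R^2,\mathbb C)\otimes\mathcal S(\mathbb R)\big)\cap\mathrm{Ker}(D_s)$$ be the space of symplectic monogenics homogeneous of degree $h$ in $x,y$, with the topology induced from $\mathrm{Pol}_h(\mathbb R^2,\mathbb C)\otimes\mathcal S(\mathbb R)\cong\mathcal S(\mathbb R)^{h+1}$ (convergence in $\mathcal S(\mathbb R)$ of the coefficient of each monomial $x^ay^b$). A family in a topological vector space is called a topological basis if it is linearly independent, no member lies in the closed linear span of the other members, and its linear span is dense. Then, for every $h\in\mathbb N_0$, the spinors $$\tilde s_{o,k}^h=e^{-\frac{q^2}{2}}\sum_{p=0}^h(-1)^p\frac{(2k+1)!!}{(2k-2p+1)!!}\binom hp q^{2k+1-2p}(x+\mathrm i y)^{h-p}(\mathrm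 i y)^p,\qquad k\in\mathbb N_0,\ k\ge h,$$ belong to, and form a topological basis of, the subspace of those elements of $M_h^s$ that are odd in $q$; and the spinors $$\tilde s_{e,k}^h=e^{-\frac{q^2}{2}}\sum_{p=0}^{h}(-1)^p\frac{(2k)!!}{(2k-2p)!!}\binom hp q^{2k-2p}(x+\mathrm i y)^{h-p}(\mathrm i y)^p,\qquad k\in\mathbb N_0,$$ belong to, and form a topological basis of, the subspace of those elements of $M_h^s$ that are even in $q$. Here $0!!=1$, and in the second formula the terms with $p>k$ are zero (the convention $1/(2k-2p)!!=0$ for $2k-2p<0$). -/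

import Mathlib

open scoped SchwartzMap TensorProduct Nat

/-- A topological basis of a topological vector space `V`: a family that is linearly independent,
topologically free (no member lies in the closed linear span of the others), and total (its linear
span is dense in `V`). -/
structure IsTopologicalVectorBasis {ι V : Type*} [AddCommGroup V] [Module ℂ V] [TopologicalSpace V]
    (s : ι → V) : Prop where
  linearIndependent : LinearIndependent ℂ s
  topologicallyFree : ∀ i, s i ∉ closure (Submodule.span ℂ (s '' {i}ᶜ) : Set V)
  dense_span : Dense (Submodule.span ℂ (Set.range s) : Set V)

namespace SymplecticDirac

noncomputable section

/-! ### The Gaussian and its products with monomials as Schwartz functions -/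

theorem abs_pow_mul_gaussian_le (m : ℕ) (x : ℝ) :
    |x| ^ m * Real.exp (-(x ^ 2 / 2)) ≤ 1 + 2 ^ m * m ! := by
  have h1 : (x ^ 2 / 2) ^ m / m ! ≤ Real.exp (x ^ 2 / 2) :=
    Real.pow_div_factorial_le_exp _ (by positivity) m
  have h2 : (|x| ^ m) ^ 2 ≤ 2 ^ m * m ! * Real.exp (x ^ 2 / 2) := by
    rw [div_le_iff₀ (by positivity), div_pow, div_le_iff₀ (by positivity)] at h1
    calc (|x| ^ m) ^ 2 = (x ^ 2) ^ m := by rw [← pow_mul, mul_comm, pow_mul, sq_abs]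
      _ ≤ _ := by linarith
  have h3 : |x| ^ m ≤ 1 + (|x| ^ m) ^ 2 := by nlinarith [sq_nonneg (|x| ^ m - 1), sq_nonneg (|x| ^ m)]
  have h4 : (1 : ℝ) ≤ Real.exp (x ^ 2 / 2) := Real.one_le_exp (by positivity)
  rw [Real.exp_neg, ← div_eq_mul_inv, div_le_iff₀ (Real.exp_pos _)]
  nlinarith

theorem exists_bound_poly_mul_gaussian (P : Polynomial ℝ) :
    ∃ C : ℝ, ∀ x : ℝ, |P.eval x * Real.exp (-(x ^ 2 / 2))| ≤ C := by
  induction P using Polynomial.induction_on' with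
  | add p q hp hq =>
    obtain ⟨C, hC⟩ := hp
    obtain ⟨D, hD⟩ := hq
    refine ⟨C + D, fun x => ?_⟩
    rw [Polynomial.eval_add, add_mul]
    exact (abs_add_le _ _).trans (add_le_add (hC x) (hD x))
  | monomial n a =>
    refine ⟨|a| * (1 + 2 ^ n * n !), fun x => ?_⟩
    rw [Polynomial.eval_monomial, mul_assoc, abs_mul, abs_mul, abs_pow, Real.abs_exp]
    exact mul_le_mul_of_nonneg_left (abs_pow_mul_gaussian_le n x) (abs_nonneg a)

/-- The real Schwartz function `q ↦ exp (-q ^ 2 / 2)`. -/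
def realGaussian : 𝓢(ℝ, ℝ) where
  toFun q := Real.exp (-(q ^ 2 / 2))
  smooth' := by fun_prop
  decay' k n := by
    obtain ⟨C, hC⟩ := exists_bound_poly_mul_gaussian
      (Polynomial.X ^ k * (Polynomial.hermite n).map (Int.castRingHom ℝ))
    refine ⟨C, fun x => ?_⟩
    refine le_trans (le_of_eq ?_) (hC x)
    rw [norm_iteratedFDeriv_eq_norm_iteratedDeriv, iteratedDeriv_eq_iterate,
      Polynomial.deriv_gaussian_eq_hermite_mul_gaussian, Polynomial.eval_mul, Polynomial.eval_pow,
      Polynomial.eval_X, Polynomial.eval_map, Polynomial.aeval_def]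
    simp [abs_mul, mul_assoc]

/-- The Schwartz function `q ↦ exp (-q ^ 2 / 2)` with complex values. -/
def gaussian : 𝓢(ℝ, ℂ) := SchwartzMap.postcompCLM (𝕜 := ℝ) Complex.ofRealCLM realGaussian

/-- Multiplication by the variable `q` on Schwartz space. -/
def mulQ : 𝓢(ℝ, ℂ) →L[ℂ] 𝓢(ℝ, ℂ) := SchwartzMap.smulLeftCLM ℂ (fun q : ℝ => (q : ℂ))

/-- The derivative `∂_q` on Schwartz space. -/
def derivQ : 𝓢(ℝ, ℂ) →L[ℂ] 𝓢(ℝ, ℂ) := SchwartzMap.derivCLM ℂ ℂ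

/-- The reflection `φ(q) ↦ φ(-q)` on Schwartz space. -/
def reflectQ : 𝓢(ℝ, ℂ) →L[ℂ] 𝓢(ℝ, ℂ) :=
  SchwartzMap.compCLMOfContinuousLinearEquiv ℂ (ContinuousLinearEquiv.neg ℝ)

/-- The Schwartz function `q ↦ q ^ j * exp (-q ^ 2 / 2)`. -/
def gaussMonomial (j : ℕ) : 𝓢(ℝ, ℂ) := (mulQ ^ j) gaussian

theorem gaussian_apply (q : ℝ) : gaussian q = (Real.exp (-(q ^ 2 / 2)) : ℂ) := rfl

theorem mulQ_apply (f : 𝓢(ℝ, ℂ)) (q : ℝ) : mulQ f q = (q : ℂ) * f q := by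
  rw [mulQ, SchwartzMap.smulLeftCLM_apply_apply Function.Complex.hasTemperateGrowth_ofReal, smul_eq_mul]

theorem derivQ_apply (f : 𝓢(ℝ, ℂ)) (q : ℝ) : derivQ f q = deriv f q := rfl

theorem reflectQ_apply (f : 𝓢(ℝ, ℂ)) (q : ℝ) : reflectQ f q = f (-q) := rfl

theorem gaussMonomial_apply (j : ℕ) (q : ℝ) :
    gaussMonomial j q = (q : ℂ) ^ j * (Real.exp (-(q ^ 2 / 2)) : ℂ) := by
  induction j with
  | zero => simp [gaussMonomial, gaussian_apply]
  | succ j ih =>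
    have h : gaussMonomial (j + 1) = mulQ (gaussMonomial j) := by
      simp only [gaussMonomial, pow_succ']
      rfl
    rw [h, mulQ_apply, ih]
    ring

/-! ### Polynomial symplectic spinors on the plane -/

/-- Polynomial symplectic spinors `Pol(ℝ², ℂ) ⊗ 𝓢(ℝ)`; the polynomial variables `X 0`, `X 1` are
the coordinates `x`, `y` of the plane. -/
abbrev Spinor : Type := MvPolynomial (Fin 2) ℂ ⊗[ℂ] 𝓢(ℝ, ℂ)

/-- The symplectic Dirac operator `D_s = i q ∂_y - ∂_x ∂_q`. -/
def diracOp : Spinor →ₗ[ℂ] Spinor :=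
  Complex.I • TensorProduct.map (MvPolynomial.pderiv (R := ℂ) (1 : Fin 2)).toLinearMap
      mulQ.toLinearMap
    - TensorProduct.map (MvPolynomial.pderiv (R := ℂ) (0 : Fin 2)).toLinearMap derivQ.toLinearMap

/-- `Pol_h(ℝ², ℂ) ⊗ 𝓢(ℝ)`, the spinors of homogeneity `h` in `x, y`. -/
def homogeneousSpinors (h : ℕ) : Submodule ℂ Spinor :=
  LinearMap.range ((MvPolynomial.homogeneousSubmodule (Fin 2) ℂ h).subtype.rTensor 𝓢(ℝ, ℂ))

/-- The symplectic monogenics `M_h^s` of homogeneity `h`. -/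
def monogenics (h : ℕ) : Submodule ℂ Spinor := homogeneousSpinors h ⊓ LinearMap.ker diracOp

/-- The reflection `f(x, y, q) ↦ f(x, y, -q)` of spinors. -/
def reflectSpinor : Spinor →ₗ[ℂ] Spinor := reflectQ.toLinearMap.lTensor (MvPolynomial (Fin 2) ℂ)

/-- The symplectic monogenics of homogeneity `h` that are odd in `q`. -/
def oddMonogenics (h : ℕ) : Submodule ℂ Spinor :=
  monogenics h ⊓ LinearMap.ker (reflectSpinor + LinearMap.id)

/-- The symplectic monogenics of homogeneity `h` that are even in `q`. -/
def evenMonogenics (h : ℕ) : Submodule ℂ Spinor :=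
  monogenics h ⊓ LinearMap.ker (reflectSpinor - LinearMap.id)

/-- The coefficient in `𝓢(ℝ)` of the monomial `x ^ (m 0) * y ^ (m 1)` of a spinor. -/
def spinorCoeff (m : Fin 2 →₀ ℕ) : Spinor →ₗ[ℂ] 𝓢(ℝ, ℂ) :=
  (TensorProduct.lid ℂ 𝓢(ℝ, ℂ)).toLinearMap ∘ₗ
    (MvPolynomial.lcoeff ℂ m).rTensor 𝓢(ℝ, ℂ)

/-- The topology of convergence in `𝓢(ℝ)` of every coefficient. On the subspace
`Pol_h ⊗ 𝓢(ℝ) ≃ 𝓢(ℝ) ^ (h + 1)` it is the product of the Schwartz topologies, the canonical topology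
of the tensor product of a finite-dimensional space with `𝓢(ℝ)`. -/
instance spinorTopology : TopologicalSpace Spinor :=
  TopologicalSpace.induced (fun f (m : Fin 2 →₀ ℕ) => spinorCoeff m f) inferInstance

/-! ### The explicit spinors -/

/-- The polynomial `(x + i y) ^ (h - p) * (i y) ^ p`, for `p ≤ h`. -/
def holPoly (h p : ℕ) : MvPolynomial (Fin 2) ℂ :=
  (MvPolynomial.X 0 + MvPolynomial.C Complex.I * MvPolynomial.X 1) ^ (h - p)
    * (MvPolynomial.C Complex.I * MvPolynomial.X 1) ^ p

/-- The odd spinor, for `h ≤ k`: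
`exp (-q²/2) ∑_{p=0}^h (-1)^p (2k+1)‼ / (2k-2p+1)‼ (h choose p) q^(2k+1-2p) (x+iy)^(h-p) (iy)^p`. -/
def oddSpinor (h k : ℕ) : Spinor :=
  ∑ p ∈ Finset.range (h + 1),
    ((-1) ^ p * (((2 * k + 1)‼ : ℂ) / ((2 * k + 1 - 2 * p)‼ : ℂ)) * (h.choose p : ℂ)) •
      (holPoly h p ⊗ₜ[ℂ] gaussMonomial (2 * k + 1 - 2 * p))

/-- The even spinor
`exp (-q²/2) ∑_{p=0}^h (-1)^p (2k)‼ / (2k-2p)‼ (h choose p) q^(2k-2p) (x+iy)^(h-p) (iy)^p`,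
where the terms with `p > k` vanish by the convention `1 / (2k-2p)‼ = 0` for negative `2k - 2p`. -/
def evenSpinor (h k : ℕ) : Spinor :=
  ∑ p ∈ Finset.range (h + 1),
    if p ≤ k then
      ((-1) ^ p * (((2 * k)‼ : ℂ) / ((2 * k - 2 * p)‼ : ℂ)) * (h.choose p : ℂ)) •
        (holPoly h p ⊗ₜ[ℂ] gaussMonomial (2 * k - 2 * p))
    else 0

end

end SymplecticDirac

/-!
In the coordinates `u = x + i y`, `v = i y` the Dirac operator is `-((q + ∂_q) ∂_u + q ∂_v)`. A
spinor `∑ p ≤ h, (h choose p) u ^ (h - p) v ^ p ⊗ f_p` is therefore monogenic iff `q f_{p+1} = -(q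
+ ∂_q) f_p` for all `p < h` (`diracOp_sum_holPoly_eq_zero_iff`), so it is determined by its leading
coefficient `f_0`, the coefficient of `x ^ h`. The recursion is `f_{p+1} = L f_p` for the operator
`L = -(1/q)(q + ∂_q)`. Subtracting a multiple of the Gaussian before dividing by `q` makes `L` a
continuous operator `lower` on the whole Schwartz space, and the recursion is solvable iff `(L ^ p
f_0)'(0) = 0` for `p < h` (`toSpinor_mem_monogenics`, `exists_eq_toSpinor`). For even `f_0` this
always holds; for odd `f_0` it is a system of `h` linear conditions.

Since `L (q ^ (n + 2) G) = -(n + 2) q ^ n G` with `G = exp (-q ^ 2 / 2)`, and `L` kills `G` and `q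
G`, the explicit spinors are those with leading coefficient `q ^ (2 k) G` or `q ^ (2 k + 1) G`. The
functionals `f ↦ (L ^ j f)(0)` and `f ↦ (L ^ j f)'(0)` of the leading coefficient are continuous
and dual to these families, which gives independence and topological freeness
(`isTopologicalVectorBasis_of_dual`).

Totality follows from the density of the functions `q ^ n G` in Schwartz space
(`gaussClosure_eq_top`), transported by the continuous map `toSpinor`, composed with the projection
onto even functions, or with the projection onto odd functions and a finite-rank correction
(`killLowOdd`) that enforces the `h` conditions. For the density, the Fourier transform of a
compactly supported function has a power series with coefficients of exponential type, so its
product with `G` is a convergent series of functions `q ^ n G`. Compactly supported functions are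
dense and the Fourier transform is onto, so all products of `G` with Schwartz functions are in the
closure; every compactly supported function is such a product.
-/

/-! ### Topological bases from dual functionals -/

/-- A total family with a biorthogonal (up to nonzero factors) family of continuous functionals is a
topological basis. -/
theorem isTopologicalVectorBasis_of_dual {ι V : Type*} [AddCommGroup V] [Module ℂ V]
    [TopologicalSpace V] {s : ι → V} (ℓ : ι → V →ₗ[ℂ] ℂ) (hc : ∀ i, Continuous (ℓ i))
    (h0 : ∀ i j, j ≠ i → ℓ i (s j) = 0) (h1 : ∀ i, ℓ i (s i) ≠ 0)
    (hd : Dense (Submodule.span ℂ (Set.range s) : Set V)) : IsTopologicalVectorBasis s := by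
  have hfree : ∀ i, s i ∉ closure (Submodule.span ℂ (s '' {i}ᶜ) : Set V) := by
    intro i hi
    have hker : Submodule.span ℂ (s '' {i}ᶜ) ≤ LinearMap.ker (ℓ i) := by
      rw [Submodule.span_le]
      rintro _ ⟨j, hj, rfl⟩
      exact h0 i j hj
    have hcl : IsClosed (LinearMap.ker (ℓ i) : Set V) := isClosed_singleton.preimage (hc i)
    exact h1 i (closure_minimal hker hcl hi)
  refine ⟨?_, hfree, hd⟩
  rw [linearIndependent_iff_notMem_span]
  intro i hi
  rw [← Set.compl_eq_univ_sdiff] at hi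
  exact hfree i (subset_closure hi)

namespace SymplecticDirac

noncomputable section

open Filter Topology

/-! ### Seminorms and series in Schwartz space -/

theorem tendsto_schwartz {ι : Type*} {l : Filter ι} {u : ι → 𝓢(ℝ, ℂ)} {f : 𝓢(ℝ, ℂ)}
    (h : ∀ k n, Tendsto (fun i => SchwartzMap.seminorm ℂ k n (u i - f)) l (𝓝 0)) :
    Tendsto u l (𝓝 f) := by
  rw [(schwartz_withSeminorms ℂ ℝ ℂ).tendsto_nhds]
  rintro ⟨k, n⟩ ε hε
  exact (h k n).eventually_lt_const hε

theorem iteratedDeriv_succ_eq_derivQ (f : 𝓢(ℝ, ℂ)) (n : ℕ) :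
    iteratedDeriv (n + 1) f = iteratedDeriv n (derivQ f) := by
  rw [iteratedDeriv_succ']
  rfl

theorem seminorm_succ_le_seminorm_derivQ (k n : ℕ) (f : 𝓢(ℝ, ℂ)) :
    SchwartzMap.seminorm ℂ k (n + 1) f ≤ SchwartzMap.seminorm ℂ k n (derivQ f) := by
  refine SchwartzMap.seminorm_le_bound' ℂ k (n + 1) f (apply_nonneg _ _) fun x => ?_
  rw [iteratedDeriv_succ_eq_derivQ]
  exact SchwartzMap.le_seminorm' ℂ k n (derivQ f) x

/-- A series of Schwartz functions that is absolutely summable for every seminorm converges in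
Schwartz space to its pointwise sum, as soon as the latter is known to be a Schwartz function. -/
theorem hasSum_schwartz {u : ℕ → 𝓢(ℝ, ℂ)} {f : 𝓢(ℝ, ℂ)}
    (hf : ∀ x, HasSum (fun n => u n x) (f x))
    (hu : ∀ k l, Summable fun n => SchwartzMap.seminorm ℂ k l (u n)) : HasSum u f := by
  refine tendsto_schwartz fun k l => ?_
  have hfun : (f : ℝ → ℂ) = fun x => ∑' n, u n x := funext fun x => (hf x).tsum_eq.symm
  have hder : ∀ x, HasSum (fun n => iteratedFDeriv ℝ l (u n) x) (iteratedFDeriv ℝ l f x) := by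
    intro x
    have h1 : ∀ (m n : ℕ) (y : ℝ),
        ‖iteratedFDeriv ℝ m (u n) y‖ ≤ SchwartzMap.seminorm ℂ 0 m (u n) := fun m n y =>
      SchwartzMap.norm_iteratedFDeriv_le_seminorm ℂ (u n) m y
    have h2 : Summable fun n => iteratedFDeriv ℝ l (u n) x :=
      Summable.of_norm_bounded (hu 0 l) fun n => h1 l n x
    rw [hfun, iteratedFDeriv_tsum_apply (N := ⊤) (v := fun m n => SchwartzMap.seminorm ℂ 0 m (u n))
      (fun n => (u n).smooth ⊤) (fun m _ => hu 0 m) (fun m n y _ => h1 m n y) le_top x]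
    exact h2.hasSum
  refine squeeze_zero (fun _ => apply_nonneg _ _) (fun s => ?_)
    (tendsto_tsum_compl_atTop_zero fun n => SchwartzMap.seminorm ℂ k l (u n))
  have hs : Summable fun n : {n // n ∉ s} => SchwartzMap.seminorm ℂ k l (u n) :=
    (hu k l).subtype _
  refine SchwartzMap.seminorm_le_bound ℂ k l _ (tsum_nonneg fun _ => apply_nonneg _ _) fun x => ?_
  have h3 : HasSum (fun n : {n // n ∉ s} => iteratedFDeriv ℝ l (u n) x)
      (iteratedFDeriv ℝ l f x - ∑ n ∈ s, iteratedFDeriv ℝ l (u n) x) := by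
    have := (s.hasSum_compl_iff (f := fun n => iteratedFDeriv ℝ l (u n) x)
      (a := iteratedFDeriv ℝ l f x - ∑ n ∈ s, iteratedFDeriv ℝ l (u n) x))
    rw [this]
    simpa using hder x
  have h4 : iteratedFDeriv ℝ l (∑ n ∈ s, u n - f : 𝓢(ℝ, ℂ)) x
      = -(iteratedFDeriv ℝ l f x - ∑ n ∈ s, iteratedFDeriv ℝ l (u n) x) := by
    have h5 : ((∑ n ∈ s, u n - f : 𝓢(ℝ, ℂ)) : ℝ → ℂ) = (fun y => ∑ n ∈ s, u n y) - ⇑f := by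
      ext y; simp
    rw [h5, iteratedFDeriv_sub_apply, iteratedFDeriv_fun_sum_apply]
    · abel
    · exact fun n _ => (u n).contDiffAt l
    · exact ContDiffAt.sum fun n _ => (u n).contDiffAt l
    · exact f.contDiffAt l
  rw [h4, norm_neg, ← h3.tsum_eq]
  have h6 : ∀ n : {n // n ∉ s}, ‖x‖ ^ k * ‖iteratedFDeriv ℝ l (u n) x‖
      ≤ SchwartzMap.seminorm ℂ k l (u n) := fun n => SchwartzMap.le_seminorm ℂ k l (u n) x
  have h7 : Summable fun n : {n // n ∉ s} => ‖iteratedFDeriv ℝ l (u n) x‖ :=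
    Summable.of_nonneg_of_le (fun _ => norm_nonneg _)
      (fun n => SchwartzMap.norm_iteratedFDeriv_le_seminorm ℂ (u n) l x) ((hu 0 l).subtype _)
  calc ‖x‖ ^ k * ‖∑' n : {n // n ∉ s}, iteratedFDeriv ℝ l (u n) x‖
      ≤ ‖x‖ ^ k * ∑' n : {n // n ∉ s}, ‖iteratedFDeriv ℝ l (u n) x‖ := by
        gcongr; exact norm_tsum_le_tsum_norm h7
    _ = ∑' n : {n // n ∉ s}, ‖x‖ ^ k * ‖iteratedFDeriv ℝ l (u n) x‖ := tsum_mul_left.symm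
    _ ≤ _ := Summable.tsum_le_tsum h6 (h7.mul_left _) hs

/-! ### Growth of the seminorms of `q ^ n * exp (-q ^ 2 / 2)` -/

theorem mulQ_gaussMonomial (n : ℕ) : mulQ (gaussMonomial n) = gaussMonomial (n + 1) := by
  ext q
  rw [mulQ_apply, gaussMonomial_apply, gaussMonomial_apply]
  ring

theorem hasDerivAt_gaussian (q : ℝ) : HasDerivAt gaussian (-(q : ℂ) * gaussian q) q := by
  have h : HasDerivAt (fun x : ℝ => Real.exp (-(x ^ 2 / 2))) (Real.exp (-(q ^ 2 / 2)) * (-q))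
      q := by
    apply HasDerivAt.exp
    simpa using (((hasDerivAt_id q).pow 2).div_const 2).fun_neg
  have h2 : HasDerivAt gaussian ((Real.exp (-(q ^ 2 / 2)) * (-q) : ℝ) : ℂ) q := h.ofReal_comp
  convert h2 using 1
  rw [gaussian_apply]
  push_cast
  ring

theorem derivQ_gaussMonomial (n : ℕ) :
    derivQ (gaussMonomial n) = (n : ℂ) • gaussMonomial (n - 1) - gaussMonomial (n + 1) := by
  ext q
  have h0 : (gaussMonomial n : ℝ → ℂ) = fun x : ℝ => (x : ℂ) ^ n * gaussian x := by
    ext x; rw [gaussMonomial_apply, gaussian_apply]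
  have h1 : HasDerivAt (fun x : ℝ => (x : ℂ) ^ n) (n * (q : ℂ) ^ (n - 1)) q :=
    (hasDerivAt_pow n (q : ℂ)).comp_ofReal
  have h2 := (h1.fun_mul (hasDerivAt_gaussian q)).deriv
  rw [derivQ_apply, h0, h2]
  simp only [sub_apply, smul_apply, gaussMonomial_apply, gaussian_apply,
    smul_eq_mul]
  ring

/-- The maximum of `|q| ^ n * exp (-q ^ 2 / 2)` is at most `√(n!)`, from one term of the exponential
series of `q ^ 2`. -/
theorem abs_pow_mul_gaussian_le_sqrt_factorial (n : ℕ) (q : ℝ) :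
    |q| ^ n * Real.exp (-(q ^ 2 / 2)) ≤ √(n ! : ℝ) := by
  apply Real.le_sqrt_of_sq_le
  have h := Real.pow_div_factorial_le_exp (q ^ 2) (by positivity) n
  rw [div_le_iff₀ (by positivity)] at h
  have h2 : Real.exp (-(q ^ 2 / 2)) ^ 2 = (Real.exp (q ^ 2))⁻¹ := by
    rw [← Real.exp_nat_mul, ← Real.exp_neg]
    congr 1
    push_cast
    ring
  rw [mul_pow, h2, ← pow_mul, mul_comm n 2, pow_mul, sq_abs, ← div_eq_mul_inv,
    div_le_iff₀ (Real.exp_pos _)]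
  linarith

/-- Seminorms of `q ^ n * exp (-q ^ 2 / 2)` grow at most like `b ^ n * √(n!)`. Derivatives only mix
neighbouring exponents, which enlarges the base `b` by a factor `3`. -/
theorem seminorm_gaussMonomial_le (l : ℕ) : ∀ k : ℕ, ∃ C b : ℝ, 0 ≤ C ∧ 1 ≤ b ∧
    ∀ n, SchwartzMap.seminorm ℂ k l (gaussMonomial n) ≤ C * b ^ n * √(n ! : ℝ) := by
  induction l with
  | zero =>
    intro k
    refine ⟨√(2 ^ k * k ! : ℝ), 2, by positivity, by norm_num, fun n => ?_⟩
    refine SchwartzMap.seminorm_le_bound' ℂ k 0 _ (by positivity) fun x => ?_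
    rw [iteratedDeriv_zero, gaussMonomial_apply, norm_mul, norm_pow, Complex.norm_real,
      Complex.norm_real, Real.norm_eq_abs, Real.norm_eq_abs, Real.abs_exp, ← mul_assoc, ← pow_add]
    refine (abs_pow_mul_gaussian_le_sqrt_factorial _ _).trans ?_
    have h1 : (k + n)! ≤ 2 ^ (k + n) * (k ! * n !) := by
      rw [← Nat.add_choose_mul_factorial_mul_factorial k n, mul_assoc]
      exact Nat.mul_le_mul_right _ (Nat.choose_le_two_pow _ _)
    have h2 : ((k + n)! : ℝ) ≤ (2 ^ k * k ! : ℝ) * (2 ^ n) * n ! := by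
      calc ((k + n)! : ℝ) ≤ 2 ^ (k + n) * (k ! * n !) := by exact_mod_cast h1
        _ = _ := by ring
    refine (Real.sqrt_le_sqrt h2).trans ?_
    rw [Real.sqrt_mul (by positivity), Real.sqrt_mul (by positivity)]
    gcongr
    rw [Real.sqrt_le_left (by positivity)]
    exact le_self_pow₀ (one_le_pow₀ (by norm_num)) (by norm_num)
  | succ l ih =>
    intro k
    obtain ⟨C, b, hC, hb, h⟩ := ih k
    refine ⟨C * b, 3 * b, by positivity, by linarith, fun n => ?_⟩
    have hfac : √((n + 1)! : ℝ) ≤ (n + 1) * √(n ! : ℝ) := by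
      rw [Nat.factorial_succ, Nat.cast_mul, Real.sqrt_mul (by positivity)]
      gcongr
      rw [Real.sqrt_le_left (by positivity)]
      push_cast
      nlinarith [(Nat.cast_nonneg n : (0 : ℝ) ≤ n)]
    have h1 : (n : ℝ) * SchwartzMap.seminorm ℂ k l (gaussMonomial (n - 1))
        ≤ n * (C * b ^ (n + 1) * √(n ! : ℝ)) := by
      refine mul_le_mul_of_nonneg_left ((h (n - 1)).trans ?_) (Nat.cast_nonneg n)
      have e1 : b ^ (n - 1) ≤ b ^ (n + 1) := pow_le_pow_right₀ hb (by omega)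
      have e2 : ((n - 1)! : ℝ) ≤ n ! := by exact_mod_cast Nat.factorial_le (Nat.sub_le n 1)
      gcongr
    have h2 : SchwartzMap.seminorm ℂ k l (gaussMonomial (n + 1))
        ≤ C * b ^ (n + 1) * ((n + 1) * √(n ! : ℝ)) := (h (n + 1)).trans (by gcongr)
    have h3 : (2 * n + 1 : ℝ) ≤ 3 ^ n := by
      have := one_add_mul_le_pow (show (-2 : ℝ) ≤ 2 by norm_num) n
      norm_num at this
      linarith
    calc SchwartzMap.seminorm ℂ k (l + 1) (gaussMonomial n)
        ≤ SchwartzMap.seminorm ℂ k l ((n : ℂ) • gaussMonomial (n - 1) - gaussMonomial (n + 1)) := by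
          rw [← derivQ_gaussMonomial]; exact seminorm_succ_le_seminorm_derivQ k l _
      _ ≤ SchwartzMap.seminorm ℂ k l ((n : ℂ) • gaussMonomial (n - 1))
          + SchwartzMap.seminorm ℂ k l (gaussMonomial (n + 1)) := map_sub_le_add _ _ _
      _ ≤ n * (C * b ^ (n + 1) * √(n ! : ℝ)) + C * b ^ (n + 1) * ((n + 1) * √(n ! : ℝ)) := by
          rw [map_smul_eq_mul, Complex.norm_natCast]
          exact add_le_add h1 h2
      _ = C * b ^ (n + 1) * √(n ! : ℝ) * (2 * n + 1) := by ring
      _ ≤ C * b ^ (n + 1) * √(n ! : ℝ) * 3 ^ n := by gcongr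
      _ = C * b * (3 * b) ^ n * √(n ! : ℝ) := by rw [mul_pow]; ring

theorem summable_pow_div_sqrt_factorial (x : ℝ) : Summable fun n : ℕ => x ^ n / √(n ! : ℝ) := by
  refine Summable.of_norm_bounded
    (g := fun n : ℕ => √(Real.exp (4 * x ^ 2)) * (1 / 2 : ℝ) ^ n)
    ((summable_geometric_of_lt_one (by norm_num) (by norm_num)).mul_left _) fun n => ?_
  have h : (4 * x ^ 2) ^ n / n ! ≤ Real.exp (4 * x ^ 2) :=
    Real.pow_div_factorial_le_exp _ (by positivity) n
  have h2 := Real.sqrt_le_sqrt h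
  have h3 : (4 * x ^ 2) ^ n = ((2 * |x|) ^ n) ^ 2 := by
    rw [← pow_mul, mul_comm n 2, pow_mul, mul_pow 2 |x| 2, sq_abs]; norm_num
  rw [Real.sqrt_div (by positivity), h3, Real.sqrt_sq (by positivity), mul_pow] at h2
  rw [norm_div, norm_pow, Real.norm_eq_abs, Real.norm_of_nonneg (Real.sqrt_nonneg _)]
  calc |x| ^ n / √(n ! : ℝ) = 2 ^ n * |x| ^ n / √(n ! : ℝ) * (1 / 2) ^ n := by
        rw [one_div, inv_pow]; field_simp
    _ ≤ _ := by gcongr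

/-- Coefficients of exponential type multiply the functions `q ^ n * exp (-q ^ 2 / 2)` to a series
that is absolutely summable for every Schwartz seminorm. -/
theorem summable_seminorm_smul_gaussMonomial {a : ℕ → ℂ} {A R : ℝ}
    (ha : ∀ n, ‖a n‖ ≤ A * (R ^ n / n !)) (k l : ℕ) :
    Summable fun n => SchwartzMap.seminorm ℂ k l (a n • gaussMonomial n) := by
  obtain ⟨C, b, hC, hb, h⟩ := seminorm_gaussMonomial_le l k
  refine Summable.of_nonneg_of_le (fun _ => apply_nonneg _ _) (fun n => ?_)
    ((summable_pow_div_sqrt_factorial (R * b)).mul_left (A * C))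
  rw [map_smul_eq_mul]
  calc ‖a n‖ * SchwartzMap.seminorm ℂ k l (gaussMonomial n)
      ≤ A * (R ^ n / n !) * (C * b ^ n * √(n ! : ℝ)) :=
        mul_le_mul (ha n) (h n) (apply_nonneg _ _) ((norm_nonneg _).trans (ha n))
    _ = A * C * ((R * b) ^ n / √(n ! : ℝ)) := by
        have : (0 : ℝ) < n ! := by positivity
        have h2 : √(n ! : ℝ) * √(n ! : ℝ) = n ! := Real.mul_self_sqrt this.le
        have h3 : 0 < √(n ! : ℝ) := Real.sqrt_pos.2 this
        generalize √(n ! : ℝ) = s at h2 h3 ⊢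
        rw [← h2, mul_pow]
        field_simp

/-! ### Density of compactly supported functions -/

/-- The dilation `f(q) ↦ f(q / (n + 1))` of Schwartz functions. -/
def dilate (n : ℕ) : 𝓢(ℝ, ℂ) →L[ℂ] 𝓢(ℝ, ℂ) :=
  SchwartzMap.compCLMOfContinuousLinearEquiv ℂ
    (ContinuousLinearEquiv.unitsEquivAut ℝ (Units.mk0 ((n : ℝ) + 1)⁻¹ (by positivity)))

theorem dilate_apply (n : ℕ) (f : 𝓢(ℝ, ℂ)) (q : ℝ) : dilate n f q = f (q * ((n : ℝ) + 1)⁻¹) := rfl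

/-- The pointwise product of Schwartz functions. -/
def mulSchwartz : 𝓢(ℝ, ℂ) →ₗ[ℂ] 𝓢(ℝ, ℂ) →L[ℂ] 𝓢(ℝ, ℂ) :=
  SchwartzMap.pairing (ContinuousLinearMap.mul ℂ ℂ)

theorem mulSchwartz_apply (f g : 𝓢(ℝ, ℂ)) (q : ℝ) : mulSchwartz f g q = f q * g q := rfl

theorem derivQ_mulSchwartz_dilate (n : ℕ) (c f : 𝓢(ℝ, ℂ)) :
    derivQ (mulSchwartz (dilate n c) f) =
      (((n : ℝ) + 1)⁻¹ : ℂ) • mulSchwartz (dilate n (derivQ c)) f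
        + mulSchwartz (dilate n c) (derivQ f) := by
  ext q
  have h1 : HasDerivAt (fun x : ℝ => x * ((n : ℝ) + 1)⁻¹) ((n : ℝ) + 1)⁻¹ q := by
    simpa using (hasDerivAt_id q).mul_const ((n : ℝ) + 1)⁻¹
  have h2 := (c.hasDerivAt (q * ((n : ℝ) + 1)⁻¹)).scomp q h1
  have h3 := (h2.fun_mul (f.hasDerivAt q)).deriv
  have h0 : (mulSchwartz (dilate n c) f : ℝ → ℂ)
      = fun x => (c ∘ fun x : ℝ => x * ((n : ℝ) + 1)⁻¹) x * f x := rfl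
  rw [derivQ_apply, h0, h3]
  simp only [add_apply, smul_apply, mulSchwartz_apply, dilate_apply, derivQ_apply, smul_eq_mul,
    Function.comp_apply, Complex.real_smul]
  push_cast
  ring

theorem tendsto_inv_natCast_add_one : Tendsto (fun n : ℕ => ((n : ℝ) + 1)⁻¹) atTop (𝓝 0) := by
  simpa using tendsto_one_div_add_atTop_nhds_zero_nat (𝕜 := ℝ)

/-- Cutting off `f` by slow dilations of `c` converges to `c 0 • f`. A derivative of the cut-off
gains a factor `1 / (n + 1)`, which drives the induction over the order of the seminorm. -/
theorem tendsto_seminorm_mulSchwartz_dilate (l : ℕ) : ∀ (k : ℕ) (c f : 𝓢(ℝ, ℂ)),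
    Tendsto (fun n : ℕ => SchwartzMap.seminorm ℂ k l (mulSchwartz (dilate n c) f - c 0 • f))
      atTop (𝓝 0) := by
  induction l with
  | zero =>
    intro k c f
    obtain ⟨M, hM⟩ : ∃ M : ℝ, ∀ x, ‖deriv c x‖ ≤ M :=
      ⟨_, fun x => SchwartzMap.norm_le_seminorm ℂ (derivQ c) x⟩
    have hM0 : 0 ≤ M := (norm_nonneg _).trans (hM 0)
    have hlip : ∀ x : ℝ, ‖c x - c 0‖ ≤ M * |x| := fun x => by
      simpa using Convex.norm_image_sub_le_of_norm_deriv_le (f := c) (s := Set.univ)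
        (fun y _ => (c.hasDerivAt y).differentiableAt) (fun y _ => hM y) convex_univ
        (Set.mem_univ 0) (Set.mem_univ x)
    have h0 := tendsto_inv_natCast_add_one.mul_const (M * SchwartzMap.seminorm ℂ (k + 1) 0 f)
    rw [zero_mul] at h0
    refine squeeze_zero (fun _ => apply_nonneg _ _) (fun n => ?_) h0
    refine SchwartzMap.seminorm_le_bound' ℂ k 0 _
      (mul_nonneg (by positivity) (mul_nonneg hM0 (apply_nonneg _ _))) fun x => ?_
    have h1 := SchwartzMap.le_seminorm' ℂ (k + 1) 0 f x
    have h2 := hlip (x * ((n : ℝ) + 1)⁻¹)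
    rw [iteratedDeriv_zero] at h1 ⊢
    rw [sub_apply, smul_apply, mulSchwartz_apply, dilate_apply, smul_eq_mul,
      ← sub_mul, norm_mul]
    rw [abs_mul, abs_of_nonneg (show (0 : ℝ) ≤ ((n : ℝ) + 1)⁻¹ by positivity)] at h2
    calc |x| ^ k * (‖c (x * ((n : ℝ) + 1)⁻¹) - c 0‖ * ‖f x‖)
        ≤ |x| ^ k * (M * (|x| * ((n : ℝ) + 1)⁻¹) * ‖f x‖) := by gcongr
      _ = ((n : ℝ) + 1)⁻¹ * (M * (|x| ^ (k + 1) * ‖f x‖)) := by ring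
      _ ≤ _ := by gcongr
  | succ l ih =>
    intro k c f
    have h1 := (tendsto_inv_natCast_add_one.mul (ih k (derivQ c) f)).add
      (tendsto_inv_natCast_add_one.mul_const (SchwartzMap.seminorm ℂ k l (derivQ c 0 • f)))
    have h2 := h1.add (ih k c (derivQ f))
    simp only [zero_mul, add_zero] at h2
    refine squeeze_zero (fun _ => apply_nonneg _ _) (fun n => ?_) h2
    refine (seminorm_succ_le_seminorm_derivQ k l _).trans ?_
    have h3 : derivQ (mulSchwartz (dilate n c) f - c 0 • f) =
        (((n : ℝ) + 1)⁻¹ : ℂ) • (mulSchwartz (dilate n (derivQ c)) f - derivQ c 0 • f)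
        + (((n : ℝ) + 1)⁻¹ : ℂ) • (derivQ c 0 • f)
        + (mulSchwartz (dilate n c) (derivQ f) - c 0 • derivQ f) := by
      rw [map_sub, map_smul, derivQ_mulSchwartz_dilate]
      module
    have h4 : ‖(((n : ℝ) + 1)⁻¹ : ℂ)‖ = ((n : ℝ) + 1)⁻¹ := by
      rw [← Complex.ofReal_one, ← Complex.ofReal_add, ← Complex.ofReal_inv, Complex.norm_real,
        Real.norm_of_nonneg (by positivity)]
    rw [h3]
    refine (map_add_le_add _ _ _).trans (add_le_add_left ((map_add_le_add _ _ _).trans ?_) _)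
    rw [map_smul_eq_mul, map_smul_eq_mul, h4]

theorem mem_closure_hasCompactSupport (f : 𝓢(ℝ, ℂ)) :
    f ∈ closure {g : 𝓢(ℝ, ℂ) | HasCompactSupport g} := by
  let b : ContDiffBump (0 : ℝ) := ⟨1, 2, by norm_num, by norm_num⟩
  have hb : HasCompactSupport fun x => (b x : ℂ) :=
    b.hasCompactSupport.comp_left (g := fun r : ℝ => (r : ℂ)) (by simp)
  let c : 𝓢(ℝ, ℂ) := hb.toSchwartzMap (Complex.ofRealCLM.contDiff.comp b.contDiff)
  have hc0 : c 0 = 1 := by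
    have : b (0 : ℝ) = 1 := b.one_of_mem_closedBall (by simp [b])
    change ((b (0 : ℝ) : ℝ) : ℂ) = 1
    rw [this, Complex.ofReal_one]
  have hlim : Tendsto (fun n : ℕ => mulSchwartz (dilate n c) f) atTop (𝓝 f) := by
    refine tendsto_schwartz fun k l => ?_
    simpa [hc0] using tendsto_seminorm_mulSchwartz_dilate l k c f
  refine mem_closure_of_tendsto hlim (Eventually.of_forall fun n => ?_)
  have h1 : HasCompactSupport (dilate n c) :=
    hb.comp_homeomorph (Homeomorph.mulRight₀ (((n : ℝ) + 1)⁻¹) (by positivity))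
  exact h1.mul_right

/-! ### Density of polynomials times the Gaussian -/

/-- The closed linear span of the functions `q ^ n * exp (-q ^ 2 / 2)` in Schwartz space. -/
def gaussClosure : Submodule ℂ 𝓢(ℝ, ℂ) :=
  (Submodule.span ℂ (Set.range gaussMonomial)).topologicalClosure

/-- The Fourier transform of a compactly supported function is the sum of an everywhere convergent
power series with coefficients of exponential type, so its product with the Gaussian is a limit of
polynomials times the Gaussian. -/
theorem mulSchwartz_gaussian_fourier_mem {w : 𝓢(ℝ, ℂ)} (hw : HasCompactSupport w) :
    mulSchwartz gaussian (FourierTransform.fourier w) ∈ gaussClosure := by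
  obtain ⟨R, hR⟩ := hw.isCompact.isBounded.subset_closedBall 0
  have hsupp : ∀ v : ℝ, w v ≠ 0 → |v| ≤ R := fun v hv => by
    simpa using hR (subset_tsupport _ hv)
  let a : ℕ → ℂ := fun n => ∫ v : ℝ, ((-2 * Real.pi * v * Complex.I : ℂ) ^ n / n !) * w v
  have hnorm : ∀ (n : ℕ) (v : ℝ), ‖((-2 * Real.pi * v * Complex.I : ℂ) ^ n / n !) * w v‖
      ≤ (2 * Real.pi * R) ^ n / n ! * ‖w v‖ := by
    intro n v
    by_cases hv : w v = 0
    · simp [hv]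
    · have := hsupp v hv
      rw [norm_mul, norm_div, norm_pow, Complex.norm_natCast]
      simp only [norm_mul, norm_neg, Complex.norm_real, Complex.norm_I, Real.norm_eq_abs,
        Complex.norm_ofNat, abs_of_pos Real.pi_pos, mul_one]
      gcongr
  have hcont : ∀ n : ℕ, Continuous fun v : ℝ =>
      ((-2 * Real.pi * v * Complex.I : ℂ) ^ n / n !) * w v := fun n =>
    Continuous.mul (by fun_prop) w.continuous
  have hint : ∀ n : ℕ, MeasureTheory.Integrable fun v : ℝ =>
      ((-2 * Real.pi * v * Complex.I : ℂ) ^ n / n !) * w v := fun n =>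
    (hcont n).integrable_of_hasCompactSupport hw.mul_left
  have hwint : MeasureTheory.Integrable fun v => ‖w v‖ := w.integrable.norm
  have ha : ∀ n, ‖a n‖ ≤ (∫ v, ‖w v‖) * ((2 * Real.pi * R) ^ n / n !) := by
    intro n
    refine (MeasureTheory.norm_integral_le_of_norm_le (hwint.const_mul _)
      (Eventually.of_forall (hnorm n))).trans (le_of_eq ?_)
    rw [MeasureTheory.integral_const_mul, mul_comm]
  have hsum : HasSum (fun n => a n • gaussMonomial n)
      (mulSchwartz gaussian (FourierTransform.fourier w)) := by
    refine hasSum_schwartz (fun x => ?_) (summable_seminorm_smul_gaussMonomial ha)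
    let F : ℕ → ℝ → ℂ := fun n v =>
      ((-2 * Real.pi * v * Complex.I : ℂ) ^ n / n !) * w v * (x : ℂ) ^ n
    -- Expand the exponential in the Fourier integral; the support of `w` lies in `[-R, R]`.
    have hF : HasSum (fun n => ∫ v, F n v) (∫ v, ∑' n, F n v) := by
      refine MeasureTheory.hasSum_integral_of_summable_integral_norm
        (fun n => (hint n).mul_const _) ?_
      refine Summable.of_nonneg_of_le (fun n => MeasureTheory.integral_nonneg fun v =>
        norm_nonneg _)
        (fun n => ?_) ((Real.summable_pow_div_factorial (2 * Real.pi * R * |x|)).mul_right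
          (∫ v, ‖w v‖))
      rw [← MeasureTheory.integral_const_mul]
      refine MeasureTheory.integral_mono ((hint n).mul_const _).norm (hwint.const_mul _) fun v => ?_
      have h2 : ‖F n v‖ = ‖((-2 * Real.pi * v * Complex.I : ℂ) ^ n / n !) * w v‖ * |x| ^ n := by
        rw [norm_mul, norm_pow (x : ℂ), Complex.norm_real, Real.norm_eq_abs]
      change ‖F n v‖ ≤ _
      rw [h2, mul_pow _ |x| n]
      calc _ ≤ (2 * Real.pi * R) ^ n / n ! * ‖w v‖ * |x| ^ n := by
            gcongr
            exact hnorm n v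
        _ = _ := by ring
    have hexp : ∀ v : ℝ, ∑' n, F n v
        = Complex.exp (((-2 * Real.pi * v * x : ℝ) : ℂ) * Complex.I) • w v := by
      intro v
      have h1 := (NormedSpace.expSeries_div_hasSum_exp
        (((-2 * Real.pi * v * x : ℝ) : ℂ) * Complex.I)).mul_right (w v)
      rw [← Complex.exp_eq_exp_ℂ] at h1
      rw [smul_eq_mul, ← h1.tsum_eq]
      refine tsum_congr fun n => ?_
      simp only [F]
      push_cast
      ring
    have hF2 := hF.mul_left (gaussian x)
    rw [MeasureTheory.integral_congr_ae (Eventually.of_forall hexp),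
      ← Real.fourier_real_eq_integral_exp_smul, ← SchwartzMap.fourier_coe] at hF2
    have hterm : ∀ n, (a n • gaussMonomial n) x = gaussian x * ∫ v, F n v := by
      intro n
      change _ = _ * ∫ v : ℝ, ((-2 * Real.pi * v * Complex.I : ℂ) ^ n / n !) * w v * (x : ℂ) ^ n
      rw [MeasureTheory.integral_mul_const, smul_apply, smul_eq_mul, gaussMonomial_apply,
        gaussian_apply]
      ring
    simp only [hterm]
    exact hF2
  refine mem_closure_of_tendsto hsum (Eventually.of_forall fun s => ?_)
  exact Submodule.sum_mem _ fun n _ =>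
    Submodule.smul_mem _ _ (Submodule.subset_span (Set.mem_range_self n))

/-- Polynomials times the Gaussian are dense in Schwartz space: the closure contains the product of
the Gaussian with every Schwartz function, hence every compactly supported function. -/
theorem gaussClosure_eq_top : gaussClosure = ⊤ := by
  have hclosed : IsClosed (gaussClosure : Set 𝓢(ℝ, ℂ)) := Submodule.isClosed_topologicalClosure _
  have h1 : ∀ w : 𝓢(ℝ, ℂ), mulSchwartz gaussian (FourierTransform.fourier w) ∈ gaussClosure := by
    intro w
    have hc : Continuous fun w : 𝓢(ℝ, ℂ) =>
        mulSchwartz gaussian (SchwartzMap.fourierTransformCLM ℂ w) :=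
      (mulSchwartz gaussian).continuous.comp (SchwartzMap.fourierTransformCLM ℂ).continuous
    exact closure_minimal (s := {g : 𝓢(ℝ, ℂ) | HasCompactSupport g})
      (fun g hg => mulSchwartz_gaussian_fourier_mem hg) (hclosed.preimage hc)
      (mem_closure_hasCompactSupport w)
  have h2 : ∀ u : 𝓢(ℝ, ℂ), mulSchwartz gaussian u ∈ gaussClosure := fun u => by
    simpa using h1 (FourierTransformInv.fourierInv u)
  refine eq_top_iff.2 fun f _ => ?_
  refine closure_minimal (s := {g : 𝓢(ℝ, ℂ) | HasCompactSupport g}) (fun g hg => ?_) hclosed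
    (mem_closure_hasCompactSupport f)
  -- `g` is the product of the Gaussian with the compactly supported `exp (x ^ 2 / 2) * g x`.
  have hg' : HasCompactSupport fun x : ℝ => ((Real.exp (x ^ 2 / 2) : ℝ) : ℂ) * g x :=
    HasCompactSupport.mul_left hg
  have hs : ContDiff ℝ (⊤ : ℕ∞) fun x : ℝ => ((Real.exp (x ^ 2 / 2) : ℝ) : ℂ) * g x := by
    refine ContDiff.mul (Complex.ofRealCLM.contDiff.comp (Real.contDiff_exp.comp ?_)) (g.smooth ⊤)
    fun_prop
  have h3 : g = mulSchwartz gaussian (hg'.toSchwartzMap hs) := by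
    ext x
    rw [mulSchwartz_apply, gaussian_apply, HasCompactSupport.toSchwartzMap_toFun, ← mul_assoc,
      ← Complex.ofReal_mul, ← Real.exp_add]
    simp
  rw [h3]
  exact h2 _

/-! ### Division by the variable in Schwartz space -/

/-- The weighted average `∫₀¹ t ^ l * f(x t) dt` of `f` over the segment from `0` to `x`. -/
def radialAverage (l : ℕ) (f : 𝓢(ℝ, ℂ)) (x : ℝ) : ℂ := ∫ t in (0 : ℝ)..1, (t : ℂ) ^ l * f (x * t)

theorem norm_pow_mul_le_seminorm_of_mem {t : ℝ} (ht : t ∈ Set.uIoc (0 : ℝ) 1) (l : ℕ)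
    (f : 𝓢(ℝ, ℂ)) (x : ℝ) : ‖(t : ℂ) ^ l * f x‖ ≤ SchwartzMap.seminorm ℂ 0 0 f := by
  rw [Set.uIoc_of_le zero_le_one] at ht
  rw [norm_mul, norm_pow, Complex.norm_real, Real.norm_of_nonneg ht.1.le]
  calc t ^ l * ‖f x‖ ≤ 1 * ‖f x‖ := by gcongr; exact pow_le_one₀ ht.1.le ht.2
    _ ≤ _ := by rw [one_mul]; exact SchwartzMap.norm_le_seminorm ℂ f x

theorem norm_radialAverage_le (l : ℕ) (f : 𝓢(ℝ, ℂ)) (x : ℝ) :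
    ‖radialAverage l f x‖ ≤ SchwartzMap.seminorm ℂ 0 0 f := by
  simpa [radialAverage] using intervalIntegral.norm_integral_le_of_norm_le_const
    (a := (0 : ℝ)) (b := 1) (f := fun t : ℝ => (t : ℂ) ^ l * f (x * t))
    fun t ht => norm_pow_mul_le_seminorm_of_mem ht l f (x * t)

theorem hasDerivAt_radialAverage (l : ℕ) (f : 𝓢(ℝ, ℂ)) (x : ℝ) :
    HasDerivAt (radialAverage l f) (radialAverage (l + 1) (derivQ f) x) x := by
  have hc : ∀ (m : ℕ) (g : 𝓢(ℝ, ℂ)) (y : ℝ), Continuous fun t : ℝ => (t : ℂ) ^ m * g (y * t) :=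
    fun m g y => Continuous.mul (by fun_prop) (g.continuous.comp (by fun_prop))
  refine (intervalIntegral.hasDerivAt_integral_of_dominated_loc_of_deriv_le
    (F := fun y t => (t : ℂ) ^ l * f (y * t))
    (F' := fun y t => (t : ℂ) ^ (l + 1) * derivQ f (y * t))
    (bound := fun _ => SchwartzMap.seminorm ℂ 0 0 (derivQ f)) (s := Set.univ) univ_mem
    (Eventually.of_forall fun y => (hc l f y).aestronglyMeasurable)
    ((hc l f x).intervalIntegrable _ _) (hc _ _ x).aestronglyMeasurable
    (Eventually.of_forall fun t ht y _ => norm_pow_mul_le_seminorm_of_mem ht _ _ _)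
    intervalIntegrable_const (Eventually.of_forall fun t _ y _ => ?_)).2
  have h1 : HasDerivAt (fun y : ℝ => y * t) t y := by simpa using (hasDerivAt_id y).mul_const t
  have h2 := ((f.hasDerivAt (y * t)).scomp y h1).const_mul ((t : ℂ) ^ l)
  refine h2.congr_deriv ?_
  rw [derivQ_apply, Complex.real_smul]
  ring

theorem iteratedDeriv_radialAverage (n : ℕ) : ∀ (l : ℕ) (f : 𝓢(ℝ, ℂ)),
    iteratedDeriv n (radialAverage l f) = radialAverage (l + n) (derivQ^[n] f) := by
  induction n with
  | zero => intro l f; simp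
  | succ n ih =>
    intro l f
    have : deriv (radialAverage l f) = radialAverage (l + 1) (derivQ f) :=
      funext fun x => (hasDerivAt_radialAverage l f x).deriv
    rw [iteratedDeriv_succ', this, ih, Function.iterate_succ_apply, add_assoc, add_comm 1 n]

theorem contDiff_radialAverage (l : ℕ) (f : 𝓢(ℝ, ℂ)) :
    ContDiff ℝ (⊤ : ℕ∞) (radialAverage l f) := by
  refine contDiff_of_differentiable_iteratedDeriv fun m _ x => ?_
  rw [iteratedDeriv_radialAverage]
  exact (hasDerivAt_radialAverage _ _ x).differentiableAt

/-- The fundamental theorem of calculus along the segment from `0` to `x`. -/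
theorem mul_radialAverage_derivQ (f : 𝓢(ℝ, ℂ)) (x : ℝ) :
    (x : ℂ) * radialAverage 0 (derivQ f) x = f x - f 0 := by
  have h1 : ∀ t : ℝ, HasDerivAt (fun t : ℝ => f (x * t)) ((x : ℂ) * derivQ f (x * t)) t := by
    intro t
    have h2 : HasDerivAt (fun t : ℝ => x * t) x t := by simpa using (hasDerivAt_id t).const_mul x
    exact (f.hasDerivAt (x * t)).scomp t h2
  have hc : Continuous fun t : ℝ => (x : ℂ) * derivQ f (x * t) :=
    continuous_const.mul ((derivQ f).continuous.comp (by fun_prop))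
  have h3 := intervalIntegral.integral_eq_sub_of_hasDerivAt (fun t _ => h1 t)
    (hc.intervalIntegrable 0 1)
  rw [intervalIntegral.integral_const_mul] at h3
  simpa [radialAverage] using h3

theorem iteratedDeriv_eq_iterate_derivQ (n : ℕ) : ∀ f : 𝓢(ℝ, ℂ),
    iteratedDeriv n f = derivQ^[n] f := by
  induction n with
  | zero => intro f; simp
  | succ n ih => intro f; rw [iteratedDeriv_succ_eq_derivQ, ih, Function.iterate_succ_apply]

/-- The `n`-th derivative of the identity `x * g = f`, where `g` is the average of `f'`. -/
theorem mul_radialAverage_iterate (n : ℕ) {f : 𝓢(ℝ, ℂ)} (hf : f 0 = 0) : ∀ x : ℝ,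
    (x : ℂ) * radialAverage n (derivQ^[n + 1] f) x
      = derivQ^[n] f x - n * radialAverage (n - 1) (derivQ^[n] f) x := by
  induction n with
  | zero => intro x; simpa [hf] using mul_radialAverage_derivQ f x
  | succ n ih =>
    intro x
    have h1 : HasDerivAt (fun x : ℝ => (x : ℂ)) 1 x := (hasDerivAt_id (x : ℂ)).comp_ofReal
    have h2 := h1.fun_mul (hasDerivAt_radialAverage n (derivQ^[n + 1] f) x)
    have h3 : HasDerivAt (fun x : ℝ => (n : ℂ) * radialAverage (n - 1) (derivQ^[n] f) x)
        (n * radialAverage n (derivQ^[n + 1] f) x) x := by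
      rcases n with _ | n
      · simpa using hasDerivAt_const x (0 : ℂ)
      · rw [Function.iterate_succ_apply' derivQ (n + 1)]
        exact (hasDerivAt_radialAverage n _ x).const_mul _
    have h4 := ((derivQ^[n] f).hasDerivAt x).fun_sub h3
    rw [← derivQ_apply, ← Function.iterate_succ_apply' derivQ n] at h4
    rw [funext ih] at h2
    have h5 := h2.unique h4
    rw [← Function.iterate_succ_apply' derivQ (n + 1)] at h5
    rw [Nat.add_sub_cancel]
    push_cast
    linear_combination h5

/-- Weighted derivatives of `f(x) / x` are controlled by finitely many seminorms of `f`: each weight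
`x` is absorbed by means of `x * g = f`, at the cost of one derivative of `g` less. -/
theorem exists_bound_radialAverage (k : ℕ) : ∀ n : ℕ, ∃ B : 𝓢(ℝ, ℂ) → ℝ, Continuous B ∧ B 0 = 0 ∧
    ∀ f : 𝓢(ℝ, ℂ), f 0 = 0 → ∀ x : ℝ,
      |x| ^ k * ‖radialAverage n (derivQ^[n + 1] f) x‖ ≤ B f := by
  have hsem : ∀ k n : ℕ, Continuous (SchwartzMap.seminorm ℂ k n : 𝓢(ℝ, ℂ) → ℝ) := fun k n =>
    (schwartz_withSeminorms ℂ ℝ ℂ).continuous_seminorm (k, n)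
  have hder : ∀ n : ℕ, Continuous (derivQ^[n] : 𝓢(ℝ, ℂ) → 𝓢(ℝ, ℂ)) := fun n =>
    derivQ.continuous.iterate n
  have hder0 : ∀ n : ℕ, derivQ^[n] 0 = 0 := fun n => Function.iterate_fixed (map_zero _) n
  induction k with
  | zero =>
    refine fun n => ⟨fun f => SchwartzMap.seminorm ℂ 0 0 (derivQ^[n + 1] f),
      (hsem 0 0).comp (hder _), ?_, fun f _ x => ?_⟩
    · simp only [hder0, map_zero]
    · rw [pow_zero, one_mul]
      exact norm_radialAverage_le _ _ _
  | succ k ih =>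
    have hmain : ∀ (n : ℕ) (f : 𝓢(ℝ, ℂ)), f 0 = 0 → ∀ x : ℝ,
        |x| ^ (k + 1) * ‖radialAverage n (derivQ^[n + 1] f) x‖
          ≤ SchwartzMap.seminorm ℂ k n f
            + n * (|x| ^ k * ‖radialAverage (n - 1) (derivQ^[n] f) x‖) := by
      intro n f hf x
      calc |x| ^ (k + 1) * ‖radialAverage n (derivQ^[n + 1] f) x‖
          = |x| ^ k * ‖(x : ℂ) * radialAverage n (derivQ^[n + 1] f) x‖ := by
            rw [norm_mul, Complex.norm_real, Real.norm_eq_abs]; ring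
        _ ≤ |x| ^ k * (‖derivQ^[n] f x‖ + n * ‖radialAverage (n - 1) (derivQ^[n] f) x‖) := by
            rw [mul_radialAverage_iterate n hf]
            gcongr
            refine (norm_sub_le _ _).trans (le_of_eq ?_)
            rw [norm_mul, Complex.norm_natCast]
        _ = |x| ^ k * ‖derivQ^[n] f x‖
            + n * (|x| ^ k * ‖radialAverage (n - 1) (derivQ^[n] f) x‖) := by ring
        _ ≤ _ := by
            refine add_le_add_left ?_ _
            rw [← iteratedDeriv_eq_iterate_derivQ]
            exact SchwartzMap.le_seminorm' ℂ k n f x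
    rintro (_ | n)
    · refine ⟨_, hsem k 0, map_zero _, fun f hf x => ?_⟩
      simpa using hmain 0 f hf x
    · obtain ⟨B, hB, hB0, hBf⟩ := ih n
      refine ⟨fun f => SchwartzMap.seminorm ℂ k (n + 1) f + (n + 1 : ℕ) * B f,
        (hsem k (n + 1)).add (continuous_const.mul hB), by simp [hB0], fun f hf x => ?_⟩
      exact (hmain (n + 1) f hf x).trans (add_le_add le_rfl
        (mul_le_mul_of_nonneg_left (hBf f hf x) (Nat.cast_nonneg _)))

/-- Evaluation of Schwartz functions at `0`. -/
def evalZero : 𝓢(ℝ, ℂ) →L[ℂ] ℂ :=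
  (BoundedContinuousFunction.evalCLM ℂ (0 : ℝ)).comp
    (SchwartzMap.toBoundedContinuousFunctionCLM ℂ ℝ ℂ)

theorem gaussian_zero : gaussian 0 = 1 := by simp [gaussian_apply]

/-- Two Schwartz functions with the same product by `q` agree off `0`, hence everywhere. -/
theorem mulQ_injective : Function.Injective mulQ := by
  intro f g hfg
  have h : Set.EqOn f g {0}ᶜ := by
    intro x hx
    have h1 := congrArg (fun u : 𝓢(ℝ, ℂ) => u x) hfg
    simp only [mulQ_apply] at h1
    exact mul_left_cancel₀ (Complex.ofReal_ne_zero.2 hx) h1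
  exact DFunLike.coe_injective
    (Continuous.ext_on (dense_compl_singleton (0 : ℝ)) f.continuous g.continuous h)

/-- The Schwartz function `f - f(0) * exp (-q ^ 2 / 2)`, which vanishes at `0`. -/
def subGaussian : 𝓢(ℝ, ℂ) →L[ℂ] 𝓢(ℝ, ℂ) :=
  ContinuousLinearMap.id ℂ _ - evalZero.smulRight gaussian

theorem subGaussian_apply (f : 𝓢(ℝ, ℂ)) : subGaussian f = f - f 0 • gaussian := rfl

theorem subGaussian_apply_zero (f : 𝓢(ℝ, ℂ)) : subGaussian f 0 = 0 := by
  rw [subGaussian_apply, sub_apply, smul_apply, gaussian_zero, smul_eq_mul, mul_one, sub_self]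

theorem exists_bound_divQ (k n : ℕ) : ∃ B : 𝓢(ℝ, ℂ) → ℝ, Continuous B ∧ B 0 = 0 ∧
    ∀ (f : 𝓢(ℝ, ℂ)) (x : ℝ),
      |x| ^ k * ‖iteratedDeriv n (radialAverage 0 (derivQ (subGaussian f))) x‖ ≤ B f := by
  obtain ⟨B, hB, hB0, h⟩ := exists_bound_radialAverage k n
  refine ⟨B ∘ subGaussian, hB.comp subGaussian.continuous, by simp [hB0], fun f x => ?_⟩
  rw [iteratedDeriv_radialAverage, zero_add, ← Function.iterate_succ_apply]
  exact h _ (subGaussian_apply_zero f) x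

/-- The quotient `(f(q) - f(0) * exp (-q ^ 2 / 2)) / q` as a Schwartz function. -/
def divQFun (f : 𝓢(ℝ, ℂ)) : 𝓢(ℝ, ℂ) where
  toFun := radialAverage 0 (derivQ (subGaussian f))
  smooth' := contDiff_radialAverage _ _
  decay' k n := by
    obtain ⟨B, -, -, h⟩ := exists_bound_divQ k n
    refine ⟨B f, fun x => ?_⟩
    rw [norm_iteratedFDeriv_eq_norm_iteratedDeriv, Real.norm_eq_abs]
    exact h f x

theorem mulQ_divQFun (f : 𝓢(ℝ, ℂ)) : mulQ (divQFun f) = subGaussian f := by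
  ext x
  rw [mulQ_apply]
  have := mul_radialAverage_derivQ (subGaussian f) x
  rw [subGaussian_apply_zero, sub_zero] at this
  exact this

/-- `divQFun` as a linear map. -/
def divQLinear : 𝓢(ℝ, ℂ) →ₗ[ℂ] 𝓢(ℝ, ℂ) where
  toFun := divQFun
  map_add' f g := mulQ_injective (by simp only [map_add, mulQ_divQFun])
  map_smul' c f := mulQ_injective (by simp only [map_smul, mulQ_divQFun, RingHom.id_apply])

/-- The continuous operator `f ↦ (f(q) - f(0) * exp (-q ^ 2 / 2)) / q` on Schwartz space. On
functions vanishing at `0` it is the division by `q`. -/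
def divQ : 𝓢(ℝ, ℂ) →L[ℂ] 𝓢(ℝ, ℂ) where
  toLinearMap := divQLinear
  cont := by
    refine continuous_of_continuousAt_zero divQLinear ?_
    rw [ContinuousAt, map_zero]
    refine tendsto_schwartz fun k n => ?_
    obtain ⟨B, hB, hB0, h⟩ := exists_bound_divQ k n
    have hlim : Tendsto B (𝓝 0) (𝓝 0) := by simpa [hB0] using hB.tendsto 0
    refine squeeze_zero (fun _ => apply_nonneg _ _) (fun f => ?_) hlim
    rw [sub_zero]
    exact SchwartzMap.seminorm_le_bound' ℂ k n _
      ((by positivity : (0 : ℝ) ≤ _).trans (h f 0)) (h f)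

theorem mulQ_divQ (f : 𝓢(ℝ, ℂ)) : mulQ (divQ f) = f - f 0 • gaussian := mulQ_divQFun f

/-! ### The lowering operator -/

/-- The lowering operator `f ↦ -(1/q) * (q + ∂_q) f`, regularised at `q = 0` so that it is defined
and continuous on the whole Schwartz space. It relates consecutive components of a monogenic. -/
def lower : 𝓢(ℝ, ℂ) →L[ℂ] 𝓢(ℝ, ℂ) := -ContinuousLinearMap.id ℂ _ - divQ.comp derivQ

theorem mulQ_lower (f : 𝓢(ℝ, ℂ)) :
    mulQ (lower f) = -(mulQ f + derivQ f) + derivQ f 0 • gaussian := by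
  have : lower f = -f - divQ (derivQ f) := rfl
  rw [this, map_sub, map_neg, mulQ_divQ]
  abel

theorem gaussMonomial_zero_zero : gaussMonomial 0 0 = 1 := by simp [gaussMonomial_apply]

theorem gaussMonomial_succ_zero (n : ℕ) : gaussMonomial (n + 1) 0 = 0 := by
  simp [gaussMonomial_apply]

theorem lower_gaussMonomial_zero : lower (gaussMonomial 0) = 0 := by
  apply mulQ_injective
  rw [mulQ_lower, derivQ_gaussMonomial, mulQ_gaussMonomial]
  simp [gaussMonomial_succ_zero]

theorem lower_gaussMonomial_one : lower (gaussMonomial 1) = 0 := by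
  apply mulQ_injective
  have h : gaussMonomial 0 = gaussian := by simp [gaussMonomial]
  rw [mulQ_lower, derivQ_gaussMonomial, mulQ_gaussMonomial]
  simp [sub_apply, gaussMonomial_succ_zero, h, gaussian_zero]

theorem lower_gaussMonomial_add_two (n : ℕ) :
    lower (gaussMonomial (n + 2)) = (-(n + 2) : ℂ) • gaussMonomial n := by
  apply mulQ_injective
  rw [mulQ_lower, derivQ_gaussMonomial, mulQ_gaussMonomial, map_smul, mulQ_gaussMonomial]
  simp only [sub_apply, smul_apply, gaussMonomial_succ_zero,
    show n + 2 - 1 = n + 1 by omega]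
  push_cast
  module

theorem reflectQ_gaussMonomial (n : ℕ) :
    reflectQ (gaussMonomial n) = (-1 : ℂ) ^ n • gaussMonomial n := by
  ext q
  rw [reflectQ_apply, smul_apply, gaussMonomial_apply, gaussMonomial_apply, smul_eq_mul,
    ← mul_assoc, ← mul_pow]
  simp

theorem reflectQ_mulQ (f : 𝓢(ℝ, ℂ)) : reflectQ (mulQ f) = -mulQ (reflectQ f) := by
  ext q
  rw [reflectQ_apply, neg_apply, mulQ_apply, mulQ_apply, reflectQ_apply]
  push_cast
  ring

theorem reflectQ_derivQ (f : 𝓢(ℝ, ℂ)) : reflectQ (derivQ f) = -derivQ (reflectQ f) := by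
  ext q
  have : (reflectQ f : ℝ → ℂ) = fun x => f (-x) := rfl
  rw [reflectQ_apply, neg_apply, derivQ_apply, derivQ_apply, this, deriv_comp_neg, neg_neg]

theorem reflectQ_lower (f : 𝓢(ℝ, ℂ)) : reflectQ (lower f) = lower (reflectQ f) := by
  apply mulQ_injective
  have h1 := congrArg reflectQ (mulQ_lower f)
  have h2 : reflectQ gaussian = gaussian := by
    simpa [gaussMonomial] using reflectQ_gaussMonomial 0
  have h3 : derivQ f 0 = -derivQ (reflectQ f) 0 := by
    rw [← neg_apply, ← reflectQ_derivQ, reflectQ_apply, neg_zero]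
  rw [reflectQ_mulQ, map_add, map_neg, map_add, map_smul, h2, reflectQ_mulQ, reflectQ_derivQ,
    h3] at h1
  rw [mulQ_lower, ← neg_neg (mulQ (reflectQ (lower f))), h1]
  module

/-! ### Holomorphic coordinates on the plane -/

/-- The substitution `x ↦ x + i y`, `y ↦ i y`. -/
def toHol : MvPolynomial (Fin 2) ℂ →ₐ[ℂ] MvPolynomial (Fin 2) ℂ :=
  MvPolynomial.aeval ![MvPolynomial.X 0 + MvPolynomial.C Complex.I * MvPolynomial.X 1,
    MvPolynomial.C Complex.I * MvPolynomial.X 1]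

/-- The substitution `x ↦ x - y`, `y ↦ -i y`, inverse to `toHol`. -/
def ofHol : MvPolynomial (Fin 2) ℂ →ₐ[ℂ] MvPolynomial (Fin 2) ℂ :=
  MvPolynomial.aeval ![MvPolynomial.X 0 - MvPolynomial.X 1,
    -(MvPolynomial.C Complex.I * MvPolynomial.X 1)]

theorem C_I_mul_C_I_mul (P : MvPolynomial (Fin 2) ℂ) :
    MvPolynomial.C Complex.I * (MvPolynomial.C Complex.I * P) = -P := by
  rw [← mul_assoc, ← MvPolynomial.C_mul, Complex.I_mul_I, MvPolynomial.C_neg, MvPolynomial.C_1,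
    neg_one_mul]

theorem toHol_ofHol (P : MvPolynomial (Fin 2) ℂ) : toHol (ofHol P) = P := by
  have : toHol.comp ofHol = AlgHom.id ℂ _ := by
    refine MvPolynomial.algHom_ext fun i => ?_
    fin_cases i
    · simp [toHol, ofHol]
    · simp [toHol, ofHol, C_I_mul_C_I_mul]
  exact DFunLike.congr_fun this P

theorem ofHol_holPoly (h p : ℕ) :
    ofHol (holPoly h p) = MvPolynomial.X 0 ^ (h - p) * MvPolynomial.X 1 ^ p := by
  simp [ofHol, holPoly, C_I_mul_C_I_mul]

theorem toHol_X_pow_mul_X_pow (h p : ℕ) :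
    toHol (MvPolynomial.X 0 ^ (h - p) * MvPolynomial.X 1 ^ p) = holPoly h p := by
  simp [toHol, holPoly]

theorem isHomogeneous_ofHol {h : ℕ} {P : MvPolynomial (Fin 2) ℂ} (hP : P.IsHomogeneous h) :
    (ofHol P).IsHomogeneous h := by
  have := hP.aeval (n := 1) (![MvPolynomial.X 0 - MvPolynomial.X 1,
    -(MvPolynomial.C Complex.I * MvPolynomial.X 1)] : Fin 2 → MvPolynomial (Fin 2) ℂ) fun i => ?_
  · rwa [one_mul] at this
  · fin_cases i
    · exact (MvPolynomial.isHomogeneous_X ℂ 0).sub (MvPolynomial.isHomogeneous_X ℂ 1)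
    · exact (MvPolynomial.isHomogeneous_C_mul_X _ 1).neg

theorem isHomogeneous_holPoly {h p : ℕ} (hp : p ≤ h) : (holPoly h p).IsHomogeneous h := by
  have h1 := (((MvPolynomial.isHomogeneous_X ℂ (0 : Fin 2)).add
    (MvPolynomial.isHomogeneous_C_mul_X Complex.I (1 : Fin 2))).pow (h - p)).mul
    ((MvPolynomial.isHomogeneous_C_mul_X Complex.I (1 : Fin 2)).pow p)
  have h2 : 1 * (h - p) + 1 * p = h := by omega
  rwa [h2] at h1

theorem mem_span_holPoly {h : ℕ} {P : MvPolynomial (Fin 2) ℂ} (hP : P.IsHomogeneous h) :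
    P ∈ Submodule.span ℂ (holPoly h '' (Finset.range (h + 1) : Set ℕ)) := by
  rw [← toHol_ofHol P, (ofHol P).as_sum, map_sum]
  refine Submodule.sum_mem _ fun d hd => ?_
  have hdeg : d 0 + d 1 = h := by
    have := isHomogeneous_ofHol hP (MvPolynomial.mem_support_iff.1 hd)
    simpa [Finsupp.weight_apply, Finsupp.sum_fintype] using this
  have h1 : MvPolynomial.monomial d (MvPolynomial.coeff d (ofHol P))
      = MvPolynomial.coeff d (ofHol P) •
        (MvPolynomial.X 0 ^ (h - d 1) * MvPolynomial.X 1 ^ d 1) := by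
    rw [MvPolynomial.monomial_eq, MvPolynomial.smul_eq_C_mul, Finsupp.prod_fintype _ _ (by simp),
      Fin.prod_univ_two, ← hdeg, Nat.add_sub_cancel]
  rw [h1, map_smul, toHol_X_pow_mul_X_pow]
  refine Submodule.smul_mem _ _ (Submodule.subset_span ⟨d 1, ?_, rfl⟩)
  simp only [Finset.coe_range, Set.mem_Iio]
  omega

/-- The component of a spinor of homogeneity `h` along `(x + i y) ^ (h - p) * (i y) ^ p`. -/
def holComponent (h p : ℕ) : Spinor →ₗ[ℂ] 𝓢(ℝ, ℂ) :=
  (TensorProduct.lid ℂ 𝓢(ℝ, ℂ)).toLinearMap ∘ₗ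
    (MvPolynomial.lcoeff ℂ (Finsupp.single 0 (h - p) + Finsupp.single 1 p) ∘ₗ
      ofHol.toLinearMap).rTensor 𝓢(ℝ, ℂ)

theorem holComponent_tmul (h p p' : ℕ) (f : 𝓢(ℝ, ℂ)) :
    holComponent h p (holPoly h p' ⊗ₜ f) = if p' = p then f else 0 := by
  have h1 : MvPolynomial.X 0 ^ (h - p') * MvPolynomial.X 1 ^ p'
      = MvPolynomial.monomial (Finsupp.single (0 : Fin 2) (h - p') + Finsupp.single 1 p')
        (1 : ℂ) := by
    rw [MvPolynomial.X_pow_eq_monomial, MvPolynomial.X_pow_eq_monomial,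
      MvPolynomial.monomial_mul, one_mul]
  have h2 : (Finsupp.single (0 : Fin 2) (h - p') + Finsupp.single 1 p'
      = Finsupp.single (0 : Fin 2) (h - p) + Finsupp.single 1 p) ↔ p' = p := by
    refine ⟨fun e => ?_, fun e => by rw [e]⟩
    simpa using DFunLike.congr_fun e 1
  simp only [holComponent, LinearMap.comp_apply, LinearMap.rTensor_tmul, AlgHom.toLinearMap_apply,
    LinearEquiv.coe_coe, TensorProduct.lid_tmul, ofHol_holPoly, h1, MvPolynomial.lcoeff_apply,
    MvPolynomial.coeff_monomial, h2]
  split_ifs <;> simp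

theorem exists_eq_sum_holPoly_tmul {h : ℕ} {F : Spinor} (hF : F ∈ homogeneousSpinors h) :
    ∃ f : ℕ → 𝓢(ℝ, ℂ), F = ∑ p ∈ Finset.range (h + 1), (h.choose p : ℂ) • (holPoly h p ⊗ₜ f p) := by
  obtain ⟨t, rfl⟩ := hF
  induction t with
  | zero => exact ⟨0, by simp⟩
  | tmul P f =>
    obtain ⟨c, hc⟩ := (Submodule.mem_span_image_finset_iff_exists_fun' ℂ).1
      (mem_span_holPoly ((MvPolynomial.mem_homogeneousSubmodule _ _).1 P.2))
    -- Components are normalised by binomial coefficients, which makes the recursion uniform in `p`.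
    refine ⟨fun p => ((h.choose p : ℂ)⁻¹ * c p) • f, ?_⟩
    rw [LinearMap.rTensor_tmul, Submodule.subtype_apply, ← hc, TensorProduct.sum_tmul]
    refine Finset.sum_congr rfl fun p hp => ?_
    have h0 : (h.choose p : ℂ) ≠ 0 :=
      Nat.cast_ne_zero.2 (Nat.choose_pos (Nat.lt_succ_iff.1 (Finset.mem_range.1 hp))).ne'
    rw [TensorProduct.tmul_smul, smul_smul, mul_inv_cancel_left₀ h0, TensorProduct.smul_tmul']
  | add s t hs ht =>
    obtain ⟨f, hf⟩ := hs
    obtain ⟨g, hg⟩ := ht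
    refine ⟨f + g, ?_⟩
    rw [map_add, hf, hg, ← Finset.sum_add_distrib]
    simp only [Pi.add_apply, TensorProduct.tmul_add, smul_add]

theorem coeff_holPoly_single {h p : ℕ} (hp : p ≤ h) :
    MvPolynomial.coeff (Finsupp.single 0 h) (holPoly h p) = if p = 0 then 1 else 0 := by
  have hX : ∀ (n : ℕ) (Q : MvPolynomial (Fin 2) ℂ),
      MvPolynomial.coeff (Finsupp.single 0 n) (Q * MvPolynomial.X 1) = 0 := fun n Q => by
    rw [MvPolynomial.coeff_mul_X', if_neg (by simp)]
  rcases p with _ | p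
  · rw [if_pos rfl, holPoly, pow_zero, mul_one, Nat.sub_zero]
    clear hp
    induction h with
    | zero => simp
    | succ n ih =>
      rw [pow_succ, mul_add, MvPolynomial.coeff_add, ← mul_assoc, hX, add_zero,
        Finsupp.single_add, MvPolynomial.coeff_mul_X, ih]
  · rw [if_neg (Nat.succ_ne_zero p), holPoly, pow_succ, ← mul_assoc, ← mul_assoc, hX]

/-! ### The Dirac operator in holomorphic coordinates -/

theorem pderiv_zero_holPoly (h p : ℕ) :
    MvPolynomial.pderiv 0 (holPoly h p) = ((h - p : ℕ) : ℂ) • holPoly (h - 1) p := by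
  have e : h - p - 1 = h - 1 - p := by omega
  rw [holPoly, holPoly, MvPolynomial.smul_eq_C_mul, ← e]
  simp [Derivation.leibniz_pow, MvPolynomial.pderiv_X]
  ring

theorem pderiv_one_holPoly {h p : ℕ} (hp : p ≤ h) :
    MvPolynomial.pderiv 1 (holPoly h p)
      = (Complex.I * ((h - p : ℕ) : ℂ)) • holPoly (h - 1) p
        + (Complex.I * (p : ℂ)) • holPoly (h - 1) (p - 1) := by
  have e : h - p - 1 = h - 1 - p := by omega
  rcases p with _ | p
  · rw [holPoly, holPoly, MvPolynomial.smul_eq_C_mul, ← e]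
    simp [Derivation.leibniz_pow, MvPolynomial.pderiv_X]
    ring
  · have e2 : h - 1 - p = h - (p + 1) := by omega
    rw [holPoly, holPoly, holPoly, MvPolynomial.smul_eq_C_mul, MvPolynomial.smul_eq_C_mul, ← e,
      Nat.add_sub_cancel, e2]
    simp [Derivation.leibniz_pow, MvPolynomial.pderiv_X]
    ring

theorem diracOp_holPoly_tmul {h p : ℕ} (hp : p ≤ h) (f : 𝓢(ℝ, ℂ)) :
    diracOp (holPoly h p ⊗ₜ f) =
      -(((h - p : ℕ) : ℂ) • (holPoly (h - 1) p ⊗ₜ (mulQ f + derivQ f))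
        + (p : ℂ) • (holPoly (h - 1) (p - 1) ⊗ₜ mulQ f)) := by
  have h1 : diracOp (holPoly h p ⊗ₜ f) =
      Complex.I • (MvPolynomial.pderiv 1 (holPoly h p) ⊗ₜ[ℂ] mulQ f)
        - MvPolynomial.pderiv 0 (holPoly h p) ⊗ₜ[ℂ] derivQ f := rfl
  rw [h1, pderiv_zero_holPoly, pderiv_one_holPoly hp, TensorProduct.add_tmul,
    TensorProduct.tmul_add, ← TensorProduct.smul_tmul', ← TensorProduct.smul_tmul',
    ← TensorProduct.smul_tmul', smul_add, smul_smul, smul_smul, ← mul_assoc, ← mul_assoc,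
    Complex.I_mul_I]
  module

/-- In the coordinates `u = x + i y`, `v = i y` the Dirac operator couples only consecutive
components. -/
theorem diracOp_sum_holPoly (h : ℕ) (f : ℕ → 𝓢(ℝ, ℂ)) :
    diracOp (∑ p ∈ Finset.range (h + 1), (h.choose p : ℂ) • (holPoly h p ⊗ₜ f p)) =
      -∑ p ∈ Finset.range h, ((h.choose p : ℂ) * ((h - p : ℕ) : ℂ)) •
        (holPoly (h - 1) p ⊗ₜ (mulQ (f p) + derivQ (f p) + mulQ (f (p + 1)))) := by
  have h1 : ∀ p ∈ Finset.range (h + 1), diracOp ((h.choose p : ℂ) • (holPoly h p ⊗ₜ f p)) =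
      -(((h.choose p : ℂ) * ((h - p : ℕ) : ℂ)) •
          (holPoly (h - 1) p ⊗ₜ[ℂ] (mulQ (f p) + derivQ (f p)))
        + ((h.choose p : ℂ) * (p : ℂ)) • (holPoly (h - 1) (p - 1) ⊗ₜ[ℂ] mulQ (f p))) := by
    intro p hp
    rw [map_smul, diracOp_holPoly_tmul (Nat.lt_succ_iff.1 (Finset.mem_range.1 hp))]
    module
  rw [map_sum, Finset.sum_congr rfl h1, Finset.sum_neg_distrib, Finset.sum_add_distrib,
    Finset.sum_range_succ, Finset.sum_range_succ' _ h]
  simp only [Nat.sub_self, Nat.cast_zero, mul_zero, zero_smul, add_zero, Nat.add_sub_cancel]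
  rw [← Finset.sum_add_distrib]
  congr 1
  refine Finset.sum_congr rfl fun p _ => ?_
  have h2 : ((h.choose (p + 1) : ℂ) * ((p + 1 : ℕ) : ℂ))
      = (h.choose p : ℂ) * ((h - p : ℕ) : ℂ) := by
    exact_mod_cast Nat.choose_succ_right_eq h p
  rw [h2, ← smul_add, ← TensorProduct.tmul_add]

theorem diracOp_sum_holPoly_eq_zero_iff (h : ℕ) (f : ℕ → 𝓢(ℝ, ℂ)) :
    diracOp (∑ p ∈ Finset.range (h + 1), (h.choose p : ℂ) • (holPoly h p ⊗ₜ f p)) = 0 ↔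
      ∀ p < h, mulQ (f (p + 1)) = -(mulQ (f p) + derivQ (f p)) := by
  rw [diracOp_sum_holPoly, neg_eq_zero]
  refine ⟨fun H p hp => ?_, fun H => Finset.sum_eq_zero fun p hp => ?_⟩
  · have h1 := congrArg (holComponent (h - 1) p) H
    simp only [map_sum, map_smul, holComponent_tmul, map_zero, smul_ite, smul_zero,
      Finset.sum_ite_eq', Finset.mem_range, hp, if_true] at h1
    have h2 : (h.choose p : ℂ) * ((h - p : ℕ) : ℂ) ≠ 0 :=
      mul_ne_zero (Nat.cast_ne_zero.2 (Nat.choose_pos hp.le).ne')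
        (Nat.cast_ne_zero.2 (Nat.sub_pos_of_lt hp).ne')
    exact (neg_eq_of_add_eq_zero_right ((smul_eq_zero.1 h1).resolve_left h2)).symm
  · rw [H p (Finset.mem_range.1 hp), add_neg_cancel, TensorProduct.tmul_zero, smul_zero]

/-! ### Monogenics as images of their leading coefficient -/

/-- The spinor `∑ p ≤ h, (h choose p) (x + i y) ^ (h - p) (i y) ^ p ⊗ L ^ p f`, where `L` is the
lowering operator. -/
def toSpinor (h : ℕ) : 𝓢(ℝ, ℂ) →ₗ[ℂ] Spinor :=
  ∑ p ∈ Finset.range (h + 1), (h.choose p : ℂ) •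
    (TensorProduct.mk ℂ _ _ (holPoly h p) ∘ₗ (lower ^ p).toLinearMap)

theorem toSpinor_apply (h : ℕ) (f : 𝓢(ℝ, ℂ)) : toSpinor h f =
    ∑ p ∈ Finset.range (h + 1), (h.choose p : ℂ) • (holPoly h p ⊗ₜ (lower ^ p) f) := by
  simp only [toSpinor, LinearMap.sum_apply, LinearMap.smul_apply]
  rfl

theorem spinorCoeff_tmul (m : Fin 2 →₀ ℕ) (P : MvPolynomial (Fin 2) ℂ) (f : 𝓢(ℝ, ℂ)) :
    spinorCoeff m (P ⊗ₜ f) = MvPolynomial.coeff m P • f := rfl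

theorem continuous_spinorCoeff (m : Fin 2 →₀ ℕ) : Continuous (spinorCoeff m) :=
  (continuous_apply m).comp
    (continuous_induced_dom (f := fun (F : Spinor) (m : Fin 2 →₀ ℕ) => spinorCoeff m F))

theorem continuous_toSpinor (h : ℕ) : Continuous (toSpinor h) := by
  refine continuous_induced_rng.2 (continuous_pi fun m => ?_)
  have : (fun f => spinorCoeff m (toSpinor h f)) = fun f => ∑ p ∈ Finset.range (h + 1),
      (h.choose p : ℂ) • MvPolynomial.coeff m (holPoly h p) • (lower ^ p) f := by
    ext1 f
    simp only [toSpinor_apply, map_sum, map_smul, spinorCoeff_tmul]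
  change Continuous fun f => spinorCoeff m (toSpinor h f)
  rw [this]
  exact continuous_finsetSum _ fun p _ =>
    ((lower ^ p).continuous.const_smul (MvPolynomial.coeff m (holPoly h p))).const_smul
      (h.choose p : ℂ)

theorem spinorCoeff_sum_holPoly (h : ℕ) (f : ℕ → 𝓢(ℝ, ℂ)) :
    spinorCoeff (Finsupp.single 0 h)
      (∑ p ∈ Finset.range (h + 1), (h.choose p : ℂ) • (holPoly h p ⊗ₜ f p)) = f 0 := by
  rw [map_sum, Finset.sum_eq_single 0]
  · rw [map_smul, spinorCoeff_tmul, coeff_holPoly_single (Nat.zero_le h)]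
    simp
  · intro p hp hp0
    rw [map_smul, spinorCoeff_tmul,
      coeff_holPoly_single (Nat.lt_succ_iff.1 (Finset.mem_range.1 hp)), if_neg hp0, zero_smul,
      smul_zero]
  · simp

theorem spinorCoeff_toSpinor (h : ℕ) (f : 𝓢(ℝ, ℂ)) :
    spinorCoeff (Finsupp.single 0 h) (toSpinor h f) = f := by
  rw [toSpinor_apply, spinorCoeff_sum_holPoly h fun p => (lower ^ p) f]
  rfl

theorem lower_pow_succ_apply (p : ℕ) (f : 𝓢(ℝ, ℂ)) :
    (lower ^ (p + 1)) f = lower ((lower ^ p) f) := by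
  rw [pow_succ']
  rfl

theorem toSpinor_mem_monogenics {h : ℕ} {f : 𝓢(ℝ, ℂ)}
    (hf : ∀ p < h, derivQ ((lower ^ p) f) 0 = 0) : toSpinor h f ∈ monogenics h := by
  rw [toSpinor_apply]
  refine ⟨Submodule.sum_mem _ fun p hp => Submodule.smul_mem _ _ ?_, ?_⟩
  · exact ⟨⟨holPoly h p, (MvPolynomial.mem_homogeneousSubmodule _ _).2
      (isHomogeneous_holPoly (Nat.lt_succ_iff.1 (Finset.mem_range.1 hp)))⟩ ⊗ₜ (lower ^ p) f, rfl⟩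
  · refine (diracOp_sum_holPoly_eq_zero_iff h fun p => (lower ^ p) f).2 fun p hp => ?_
    rw [lower_pow_succ_apply, mulQ_lower, hf p hp, zero_smul, add_zero]

/-- A monogenic is determined by its leading coefficient `f`; solvability of the recursion for its
components at `q = 0` is expressed by the vanishing of the derivatives of `L ^ p f` at `0`. -/
theorem exists_eq_toSpinor {h : ℕ} {F : Spinor} (hF : F ∈ monogenics h) :
    ∃ f : 𝓢(ℝ, ℂ), F = toSpinor h f ∧ ∀ p < h, derivQ ((lower ^ p) f) 0 = 0 := by
  obtain ⟨f, rfl⟩ := exists_eq_sum_holPoly_tmul hF.1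
  have hrec := (diracOp_sum_holPoly_eq_zero_iff h f).1 hF.2
  have hder : ∀ p < h, derivQ (f p) 0 = 0 := by
    intro p hp
    have h1 := congrArg (fun u : 𝓢(ℝ, ℂ) => u 0) (hrec p hp)
    simp only [neg_apply, add_apply, mulQ_apply, Complex.ofReal_zero, zero_mul, zero_add] at h1
    exact neg_eq_zero.1 h1.symm
  have hlow : ∀ p ≤ h, f p = (lower ^ p) (f 0) := by
    intro p
    induction p with
    | zero => intro _; rfl
    | succ p ih =>
      intro hp
      apply mulQ_injective
      rw [hrec p hp, lower_pow_succ_apply, ← ih (Nat.le_of_succ_le hp), mulQ_lower, hder p hp,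
        zero_smul, add_zero]
  refine ⟨f 0, ?_, fun p hp => ?_⟩
  · rw [toSpinor_apply]
    refine Finset.sum_congr rfl fun p hp => ?_
    rw [hlow p (Nat.lt_succ_iff.1 (Finset.mem_range.1 hp))]
  · rw [← hlow p hp.le]
    exact hder p hp

theorem reflectQ_lower_pow (p : ℕ) (f : 𝓢(ℝ, ℂ)) :
    reflectQ ((lower ^ p) f) = (lower ^ p) (reflectQ f) := by
  induction p with
  | zero => rfl
  | succ p ih => rw [lower_pow_succ_apply, reflectQ_lower, ih, lower_pow_succ_apply]

theorem reflectSpinor_toSpinor (h : ℕ) (f : 𝓢(ℝ, ℂ)) :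
    reflectSpinor (toSpinor h f) = toSpinor h (reflectQ f) := by
  simp only [toSpinor_apply, map_sum, map_smul, ← reflectQ_lower_pow]
  rfl

theorem toSpinor_injective (h : ℕ) : Function.Injective (toSpinor h) :=
  Function.LeftInverse.injective (spinorCoeff_toSpinor h)

/-! ### Iterated lowering of the Gaussian monomials -/

theorem lower_pow_gaussMonomial (p : ℕ) : ∀ m : ℕ, (lower ^ p) (gaussMonomial (m + 2 * p)) =
    ((-1) ^ p * (((m + 2 * p)‼ : ℂ) / (m ‼ : ℂ))) • gaussMonomial m := by
  induction p with
  | zero =>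
    intro m
    have : (m ‼ : ℂ) ≠ 0 := Nat.cast_ne_zero.2 (Nat.doubleFactorial_pos m).ne'
    simp [this]
  | succ p ih =>
    intro m
    have h1 : (m ‼ : ℂ) ≠ 0 := Nat.cast_ne_zero.2 (Nat.doubleFactorial_pos m).ne'
    have h2 : ((m : ℂ) + 2) ≠ 0 := by exact_mod_cast (Nat.succ_ne_zero (m + 1))
    rw [lower_pow_succ_apply, show m + 2 * (p + 1) = m + 2 + 2 * p by ring, ih, map_smul,
      lower_gaussMonomial_add_two, smul_smul, Nat.doubleFactorial_add_two m]
    congr 1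
    push_cast
    field_simp
    ring

theorem lower_pow_gaussMonomial_eq_zero {m p : ℕ} (hmp : m < 2 * p) :
    (lower ^ p) (gaussMonomial m) = 0 := by
  induction p generalizing m with
  | zero => omega
  | succ p ih =>
    rw [pow_succ]
    change (lower ^ p) (lower (gaussMonomial m)) = 0
    match m with
    | 0 => rw [lower_gaussMonomial_zero, map_zero]
    | 1 => rw [lower_gaussMonomial_one, map_zero]
    | m + 2 => rw [lower_gaussMonomial_add_two, map_smul, ih (by omega), smul_zero]

theorem evenSpinor_eq_toSpinor (h k : ℕ) : evenSpinor h k = toSpinor h (gaussMonomial (2 * k)) := by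
  rw [evenSpinor, toSpinor_apply]
  refine Finset.sum_congr rfl fun p _ => ?_
  split_ifs with hp
  · have h1 := lower_pow_gaussMonomial p (2 * k - 2 * p)
    rw [show 2 * k - 2 * p + 2 * p = 2 * k by omega] at h1
    rw [h1, TensorProduct.tmul_smul, smul_smul, mul_comm (h.choose p : ℂ)]
  · rw [lower_pow_gaussMonomial_eq_zero (by omega), TensorProduct.tmul_zero, smul_zero]

theorem oddSpinor_eq_toSpinor {h k : ℕ} (hk : h ≤ k) :
    oddSpinor h k = toSpinor h (gaussMonomial (2 * k + 1)) := by
  rw [oddSpinor, toSpinor_apply]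
  refine Finset.sum_congr rfl fun p hp => ?_
  have hp' := Finset.mem_range.1 hp
  have h1 := lower_pow_gaussMonomial p (2 * k + 1 - 2 * p)
  rw [show 2 * k + 1 - 2 * p + 2 * p = 2 * k + 1 by omega] at h1
  rw [h1, TensorProduct.tmul_smul, smul_smul, mul_comm (h.choose p : ℂ)]

/-! ### Dual functionals -/

/-- The functional `f ↦ (L ^ j f)(0)`, dual to the even Gaussian monomials. -/
def evenFunctional (j : ℕ) : 𝓢(ℝ, ℂ) →L[ℂ] ℂ := evalZero.comp (lower ^ j)

/-- The functional `f ↦ (L ^ j f)'(0)`, dual to the odd Gaussian monomials. -/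
def oddFunctional (j : ℕ) : 𝓢(ℝ, ℂ) →L[ℂ] ℂ := evalZero.comp (derivQ.comp (lower ^ j))

theorem evenFunctional_apply (j : ℕ) (f : 𝓢(ℝ, ℂ)) : evenFunctional j f = (lower ^ j) f 0 := rfl

theorem oddFunctional_apply (j : ℕ) (f : 𝓢(ℝ, ℂ)) :
    oddFunctional j f = derivQ ((lower ^ j) f) 0 := rfl

theorem derivQ_gaussMonomial_one_zero : derivQ (gaussMonomial 1) 0 = 1 := by
  rw [derivQ_gaussMonomial, sub_apply, smul_apply, gaussMonomial_succ_zero, gaussMonomial_zero_zero]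
  simp

theorem derivQ_gaussMonomial_add_two_zero (n : ℕ) : derivQ (gaussMonomial (n + 2)) 0 = 0 := by
  rw [derivQ_gaussMonomial, sub_apply, smul_apply, gaussMonomial_succ_zero,
    show n + 2 - 1 = n + 1 by omega, gaussMonomial_succ_zero]
  simp

theorem doubleFactorial_factor_ne_zero (p m n : ℕ) :
    ((-1) ^ p * ((n ‼ : ℂ) / (m ‼ : ℂ))) ≠ 0 :=
  mul_ne_zero (pow_ne_zero _ (by norm_num)) (div_ne_zero
    (Nat.cast_ne_zero.2 (Nat.doubleFactorial_pos n).ne')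
    (Nat.cast_ne_zero.2 (Nat.doubleFactorial_pos m).ne'))

theorem evenFunctional_gaussMonomial_of_ne {j k : ℕ} (hjk : k ≠ j) :
    evenFunctional j (gaussMonomial (2 * k)) = 0 := by
  rw [evenFunctional_apply]
  rcases lt_or_gt_of_ne hjk with hlt | hgt
  · rw [lower_pow_gaussMonomial_eq_zero (by omega), zero_apply]
  · obtain ⟨d, rfl⟩ := Nat.exists_eq_add_of_lt hgt
    rw [show 2 * (j + d + 1) = 2 * d + 1 + 1 + 2 * j by ring, lower_pow_gaussMonomial, smul_apply,
      gaussMonomial_succ_zero, smul_zero]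

theorem evenFunctional_gaussMonomial_self (k : ℕ) :
    evenFunctional k (gaussMonomial (2 * k)) ≠ 0 := by
  have h := lower_pow_gaussMonomial k 0
  rw [zero_add] at h
  rw [evenFunctional_apply, h, smul_apply, gaussMonomial_zero_zero, smul_eq_mul, mul_one]
  exact doubleFactorial_factor_ne_zero _ _ _

theorem oddFunctional_gaussMonomial_of_ne {j k : ℕ} (hjk : k ≠ j) :
    oddFunctional j (gaussMonomial (2 * k + 1)) = 0 := by
  rw [oddFunctional_apply]
  rcases lt_or_gt_of_ne hjk with hlt | hgt
  · rw [lower_pow_gaussMonomial_eq_zero (by omega), map_zero derivQ, zero_apply]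
  · obtain ⟨d, rfl⟩ := Nat.exists_eq_add_of_lt hgt
    rw [show 2 * (j + d + 1) + 1 = 2 * d + 1 + 2 + 2 * j by ring, lower_pow_gaussMonomial, map_smul,
      smul_apply, derivQ_gaussMonomial_add_two_zero, smul_zero]

theorem oddFunctional_gaussMonomial_self (k : ℕ) :
    oddFunctional k (gaussMonomial (2 * k + 1)) ≠ 0 := by
  rw [oddFunctional_apply, add_comm, lower_pow_gaussMonomial, map_smul, smul_apply,
    derivQ_gaussMonomial_one_zero, smul_eq_mul, mul_one]
  exact doubleFactorial_factor_ne_zero _ _ _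

/-! ### Membership and totality -/

/-- The derivative of an even function vanishes at `0`; since `L` preserves parity, even functions
satisfy the conditions of `toSpinor_mem_monogenics`. -/
theorem derivQ_zero_of_even {f : 𝓢(ℝ, ℂ)} (hf : reflectQ f = f) : derivQ f 0 = 0 := by
  have h := congrArg (fun u : 𝓢(ℝ, ℂ) => u 0) (reflectQ_derivQ f)
  simp only [reflectQ_apply, neg_apply, neg_zero, hf] at h
  exact self_eq_neg.1 h

theorem reflectQ_gaussMonomial_two_mul (k : ℕ) :
    reflectQ (gaussMonomial (2 * k)) = gaussMonomial (2 * k) := by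
  rw [reflectQ_gaussMonomial, pow_mul]
  simp

theorem reflectQ_gaussMonomial_two_mul_add_one (k : ℕ) :
    reflectQ (gaussMonomial (2 * k + 1)) = -gaussMonomial (2 * k + 1) := by
  rw [reflectQ_gaussMonomial, pow_succ, pow_mul]
  simp

theorem evenSpinor_mem (h k : ℕ) : evenSpinor h k ∈ evenMonogenics h := by
  rw [evenSpinor_eq_toSpinor]
  refine ⟨toSpinor_mem_monogenics fun p _ => derivQ_zero_of_even ?_, ?_⟩
  · rw [reflectQ_lower_pow, reflectQ_gaussMonomial_two_mul]
  · rw [SetLike.mem_coe, LinearMap.mem_ker, LinearMap.sub_apply, LinearMap.id_apply,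
      reflectSpinor_toSpinor, reflectQ_gaussMonomial_two_mul, sub_self]

theorem oddSpinor_mem {h k : ℕ} (hk : h ≤ k) : oddSpinor h k ∈ oddMonogenics h := by
  rw [oddSpinor_eq_toSpinor hk]
  refine ⟨toSpinor_mem_monogenics fun p hp => ?_, ?_⟩
  · exact oddFunctional_gaussMonomial_of_ne (j := p) (hp.trans_le hk).ne'
  · rw [SetLike.mem_coe, LinearMap.mem_ker, LinearMap.add_apply, LinearMap.id_apply,
      reflectSpinor_toSpinor, reflectQ_gaussMonomial_two_mul_add_one, map_neg, neg_add_cancel]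

/-- By density of the Gaussian monomials in Schwartz space, spinors generated by functions `T f` are
limits of combinations of those generated by the images of the Gaussian monomials. -/
theorem toSpinor_mem_closure {h : ℕ} (T : 𝓢(ℝ, ℂ) →L[ℂ] 𝓢(ℝ, ℂ)) {W : Submodule ℂ Spinor}
    (hT : ∀ n, toSpinor h (T (gaussMonomial n)) ∈ W) (f : 𝓢(ℝ, ℂ)) :
    toSpinor h (T f) ∈ closure (W : Set Spinor) := by
  have hf : f ∈ closure (Submodule.span ℂ (Set.range gaussMonomial) : Set 𝓢(ℝ, ℂ)) := by
    have : f ∈ gaussClosure := gaussClosure_eq_top ▸ Submodule.mem_top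
    exact this
  have hspan : Submodule.span ℂ (Set.range gaussMonomial)
      ≤ W.comap (toSpinor h ∘ₗ T.toLinearMap) := by
    rw [Submodule.span_le]
    rintro _ ⟨n, rfl⟩
    exact hT n
  have hc : Continuous fun f => toSpinor h (T f) := (continuous_toSpinor h).comp T.continuous
  exact map_mem_closure (f := fun g => toSpinor h (T g)) hc hf hspan

theorem dense_span_of_forall_mem_closure {V : Submodule ℂ Spinor} {ι : Type*} {s : ι → V}
    (hs : ∀ F ∈ V,
      F ∈ closure (Submodule.span ℂ (Set.range fun i => (s i : Spinor)) : Set Spinor)) :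
    Dense (Submodule.span ℂ (Set.range s) : Set V) := by
  intro F
  rw [closure_subtype]
  have : ((↑) '' (Submodule.span ℂ (Set.range s) : Set V) : Set Spinor)
      = (Submodule.span ℂ (Set.range fun i => (s i : Spinor)) : Set Spinor) := by
    change V.subtype '' _ = _
    rw [← Submodule.map_coe, Submodule.map_span, ← Set.range_comp]
    rfl
  rw [this]
  exact hs F F.2

/-- The projection of Schwartz space onto the even functions. -/
def evenPart : 𝓢(ℝ, ℂ) →L[ℂ] 𝓢(ℝ, ℂ) := (2⁻¹ : ℂ) • (ContinuousLinearMap.id ℂ _ + reflectQ)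

/-- The projection of Schwartz space onto the odd functions. -/
def oddPart : 𝓢(ℝ, ℂ) →L[ℂ] 𝓢(ℝ, ℂ) := (2⁻¹ : ℂ) • (ContinuousLinearMap.id ℂ _ - reflectQ)

theorem evenPart_apply (f : 𝓢(ℝ, ℂ)) : evenPart f = (2⁻¹ : ℂ) • (f + reflectQ f) := rfl

theorem oddPart_apply (f : 𝓢(ℝ, ℂ)) : oddPart f = (2⁻¹ : ℂ) • (f - reflectQ f) := rfl

theorem evenPart_of_even {f : 𝓢(ℝ, ℂ)} (hf : reflectQ f = f) : evenPart f = f := by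
  rw [evenPart_apply, hf]
  module

theorem evenPart_of_odd {f : 𝓢(ℝ, ℂ)} (hf : reflectQ f = -f) : evenPart f = 0 := by
  rw [evenPart_apply, hf, add_neg_cancel, smul_zero]

theorem oddPart_of_even {f : 𝓢(ℝ, ℂ)} (hf : reflectQ f = f) : oddPart f = 0 := by
  rw [oddPart_apply, hf, sub_self, smul_zero]

theorem oddPart_of_odd {f : 𝓢(ℝ, ℂ)} (hf : reflectQ f = -f) : oddPart f = f := by
  rw [oddPart_apply, hf]
  module

theorem mem_closure_span_evenSpinor {h : ℕ} {F : Spinor} (hF : F ∈ evenMonogenics h) :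
    F ∈ closure (Submodule.span ℂ (Set.range (evenSpinor h)) : Set Spinor) := by
  obtain ⟨f, rfl, -⟩ := exists_eq_toSpinor hF.1
  have hf : reflectQ f = f := by
    have h1 := hF.2
    rw [SetLike.mem_coe, LinearMap.mem_ker, LinearMap.sub_apply, LinearMap.id_apply,
      reflectSpinor_toSpinor, sub_eq_zero] at h1
    exact toSpinor_injective h h1
  rw [← evenPart_of_even hf]
  refine toSpinor_mem_closure evenPart (fun n => ?_) f
  obtain ⟨k, rfl | rfl⟩ := n.even_or_odd'
  · rw [evenPart_of_even (reflectQ_gaussMonomial_two_mul k), ← evenSpinor_eq_toSpinor]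
    exact Submodule.subset_span (Set.mem_range_self k)
  · rw [evenPart_of_odd (reflectQ_gaussMonomial_two_mul_add_one k), map_zero]
    exact Submodule.zero_mem _

/-- The projection along `q ^ (2 j + 1) * exp (-q ^ 2 / 2)`, `j < h`, onto the common kernel of the
first `h` odd functionals. -/
def killLowOdd (h : ℕ) : 𝓢(ℝ, ℂ) →L[ℂ] 𝓢(ℝ, ℂ) :=
  ContinuousLinearMap.id ℂ _ - ∑ j ∈ Finset.range h,
    (oddFunctional j).smulRight
      ((oddFunctional j (gaussMonomial (2 * j + 1)))⁻¹ • gaussMonomial (2 * j + 1))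

theorem killLowOdd_apply (h : ℕ) (f : 𝓢(ℝ, ℂ)) :
    killLowOdd h f = f - ∑ j ∈ Finset.range h, oddFunctional j f •
      ((oddFunctional j (gaussMonomial (2 * j + 1)))⁻¹ • gaussMonomial (2 * j + 1)) := by
  simp only [killLowOdd, sub_apply, sum_apply, ContinuousLinearMap.smulRight_apply,
    ContinuousLinearMap.id_apply]

theorem killLowOdd_of_forall_eq_zero {h : ℕ} {f : 𝓢(ℝ, ℂ)}
    (hf : ∀ j < h, oddFunctional j f = 0) : killLowOdd h f = f := by
  rw [killLowOdd_apply, Finset.sum_eq_zero, sub_zero]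
  intro j hj
  rw [hf j (Finset.mem_range.1 hj), zero_smul]

theorem killLowOdd_gaussMonomial {h k : ℕ} (hk : k < h) :
    killLowOdd h (gaussMonomial (2 * k + 1)) = 0 := by
  rw [killLowOdd_apply, Finset.sum_eq_single k, smul_smul,
    mul_inv_cancel₀ (oddFunctional_gaussMonomial_self k), one_smul, sub_self]
  · intro j _ hj
    rw [oddFunctional_gaussMonomial_of_ne hj.symm, zero_smul]
  · exact fun hk' => absurd (Finset.mem_range.2 hk) hk'

theorem mem_closure_span_oddSpinor {h : ℕ} {F : Spinor} (hF : F ∈ oddMonogenics h) :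
    F ∈ closure (Submodule.span ℂ
      (Set.range fun k : {k : ℕ // h ≤ k} => oddSpinor h k) : Set Spinor) := by
  obtain ⟨f, rfl, hf0⟩ := exists_eq_toSpinor hF.1
  have hf : reflectQ f = -f := by
    have h1 := hF.2
    rw [SetLike.mem_coe, LinearMap.mem_ker, LinearMap.add_apply, LinearMap.id_apply,
      reflectSpinor_toSpinor, ← map_add] at h1
    exact eq_neg_of_add_eq_zero_left ((map_eq_zero_iff _ (toSpinor_injective h)).1 h1)
  have hf1 : f = (killLowOdd h).comp oddPart f := by
    rw [ContinuousLinearMap.comp_apply, oddPart_of_odd hf, killLowOdd_of_forall_eq_zero hf0]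
  rw [hf1]
  refine toSpinor_mem_closure _ (fun n => ?_) f
  rw [ContinuousLinearMap.comp_apply]
  obtain ⟨k, rfl | rfl⟩ := n.even_or_odd'
  · rw [oddPart_of_even (reflectQ_gaussMonomial_two_mul k), map_zero, map_zero]
    exact Submodule.zero_mem _
  · rw [oddPart_of_odd (reflectQ_gaussMonomial_two_mul_add_one k)]
    rcases lt_or_ge k h with hk | hk
    · rw [killLowOdd_gaussMonomial hk, map_zero]
      exact Submodule.zero_mem _
    · rw [killLowOdd_of_forall_eq_zero fun j hj =>
        oddFunctional_gaussMonomial_of_ne (hj.trans_le hk).ne', ← oddSpinor_eq_toSpinor hk]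
      exact Submodule.subset_span ⟨⟨k, hk⟩, rfl⟩

end

end SymplecticDirac

theorem mainTheorem5 (h : ℕ) :
    (∃ hodd : ∀ k : {k : ℕ // h ≤ k},
        SymplecticDirac.oddSpinor h k ∈ SymplecticDirac.oddMonogenics h,
      IsTopologicalVectorBasis (fun k : {k : ℕ // h ≤ k} =>
        (⟨SymplecticDirac.oddSpinor h k, hodd k⟩ : SymplecticDirac.oddMonogenics h))) ∧
    (∃ heven : ∀ k : ℕ, SymplecticDirac.evenSpinor h k ∈ SymplecticDirac.evenMonogenics h,
      IsTopologicalVectorBasis (fun k : ℕ =>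
        (⟨SymplecticDirac.evenSpinor h k, heven k⟩ : SymplecticDirac.evenMonogenics h))) := by
  -- The coefficient of `x ^ h` recovers the Schwartz function generating a monogenic.
  have hcont : ∀ (V : Submodule ℂ SymplecticDirac.Spinor) (u : 𝓢(ℝ, ℂ) →L[ℂ] ℂ), Continuous
      (u.toLinearMap ∘ₗ SymplecticDirac.spinorCoeff (Finsupp.single 0 h) ∘ₗ V.subtype) :=
    fun V u => u.continuous.comp
      ((SymplecticDirac.continuous_spinorCoeff _).comp continuous_subtype_val)
  refine ⟨⟨fun k => SymplecticDirac.oddSpinor_mem k.2, isTopologicalVectorBasis_of_dual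
      (fun j => (SymplecticDirac.oddFunctional j).toLinearMap ∘ₗ
        SymplecticDirac.spinorCoeff (Finsupp.single 0 h) ∘ₗ Submodule.subtype _)
      (fun j => hcont _ _) (fun j k hjk => ?_) (fun k => ?_)
      (SymplecticDirac.dense_span_of_forall_mem_closure
        fun F hF => SymplecticDirac.mem_closure_span_oddSpinor hF)⟩,
    ⟨SymplecticDirac.evenSpinor_mem h, isTopologicalVectorBasis_of_dual
      (fun j => (SymplecticDirac.evenFunctional j).toLinearMap ∘ₗ
        SymplecticDirac.spinorCoeff (Finsupp.single 0 h) ∘ₗ Submodule.subtype _)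
      (fun j => hcont _ _) (fun j k hjk => ?_) (fun k => ?_)
      (SymplecticDirac.dense_span_of_forall_mem_closure
        fun F hF => SymplecticDirac.mem_closure_span_evenSpinor hF)⟩⟩
  · change SymplecticDirac.oddFunctional j (SymplecticDirac.spinorCoeff (Finsupp.single 0 h)
      (SymplecticDirac.oddSpinor h k)) = 0
    rw [SymplecticDirac.oddSpinor_eq_toSpinor k.2, SymplecticDirac.spinorCoeff_toSpinor]
    exact SymplecticDirac.oddFunctional_gaussMonomial_of_ne fun e => hjk (Subtype.ext e)
  · change SymplecticDirac.oddFunctional k (SymplecticDirac.spinorCoeff (Finsupp.single 0 h)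
      (SymplecticDirac.oddSpinor h k)) ≠ 0
    rw [SymplecticDirac.oddSpinor_eq_toSpinor k.2, SymplecticDirac.spinorCoeff_toSpinor]
    exact SymplecticDirac.oddFunctional_gaussMonomial_self k
  · change SymplecticDirac.evenFunctional j (SymplecticDirac.spinorCoeff (Finsupp.single 0 h)
      (SymplecticDirac.evenSpinor h k)) = 0
    rw [SymplecticDirac.evenSpinor_eq_toSpinor, SymplecticDirac.spinorCoeff_toSpinor]
    exact SymplecticDirac.evenFunctional_gaussMonomial_of_ne hjk
  · change SymplecticDirac.evenFunctional k (SymplecticDirac.spinorCoeff (Finsupp.single 0 h)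
      (SymplecticDirac.evenSpinor h k)) ≠ 0
    rw [SymplecticDirac.evenSpinor_eq_toSpinor, SymplecticDirac.spinorCoeff_toSpinor]
    exact SymplecticDirac.evenFunctional_gaussMonomial_self k
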